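/- Work in spatial type theory: dependent type theory (a cumulative hierarchy of universes $\mathsf{Type}$, $\prod$-, $\sum$- and identity types, function extensionality, and possibly further type formers and axioms) whose judgments $\Delta\mid\Gamma\vdash\mathcal J$ have a context of crisp variables $x::A$ (in $\Delta$) and a context of ordinary, "cohesive" variables $x:A$ (in $\Gamma$). A term is crisp, written $a::A$, if it is typed over $\Delta\mid\cdot$. The modality $\sharp$ has the rules $$\frac{\Delta,\Gamma\mid\cdot\vdash A:\mathsf{Type}}{\Delta\mid\Gamma\vdash\sharp A:\mathsf{Type}}\quad \frac{\Delta,\Gamma\mid\cdot\vdash a:A}{\Delta\mid\Gamma\vdash a^\sharp:\sharp A}\quad \frac{\Delta\mid\cdot\vdash a:\sharp A}{\Delta\mid\Gamma\vdash a_\sharp:A}\quad (a^\sharp)_\sharp\equiv a,\quad (a_\sharp)^\sharp\equiv a,$$ and the modality $\flat$ has the rules $$\frac{\Delta\mid\cdot\vdash A:\mathsf{Type}}{\Delta\mid\Gamma\vdash\flat A:\mathsf{Type}}\quad \frac{\Delta\mid\cdot\vdash a:A}{\Delta\mid\Gamma\vdash a^\flat:\flat A}\quad \frac{\Delta\mid\Gamma,x:\flat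 A\vdash C:\mathsf{Type}\quad \Delta\mid\Gamma\vdash M:\flat A\quad \Delta,u::A\mid\Gamma\vdash N:C[u^\flat/x]}{\Delta\mid\Gamma\vdash(\mathsf{let}\ u^\flat:=M\ \mathsf{in}\ N):C[M/x]}$$ with $(\mathsf{let}\ u^\flat:=M^\flat\ \mathsf{in}\ N)\equiv N[M/u]$ for crisp $M$. Put $x_\flat:=(\mathsf{let}\ u^\flat:=x\ \mathsf{in}\ u)$; for $f:A\to B$ put $\sharp f(x):=f(x_\sharp)^\sharp$, and for crisp $f::A\to B$ put $\flat f(x):=(\mathsf{let}\ u^\flat:=x\ \mathsf{in}\ f(u)^\flat)$. **Theorem.** The following equivalences, between types over the crisp context, are derivable. 1. For all $A,B::\mathsf{Type}$, an equivalence $\flat(\flat A\to B)\simeq\flat(A\to\sharp B)$. In other words, $\flat$ is crisply left adjoint to $\sharp$. 2. For all $A::\mathsf{Type}$ and $B::A\to\mathsf{Type}$, an equivalence $\flat\bigl(\prod_{u:\flat A}B(u_\flat)\bigr)\simeq\flat\bigl(\prod_{x:A}\sharp B(x)\bigr)$. 3. For all $A::\mathsf{Type}$, an equivalence $\sharp\flat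 A\simeq\sharp A$. 4. For all $A::\mathsf{Type}$, an equivalence $\flat A\simeq\flat\sharp A$. Each of them is natural. For crisp types and crisp maps of the following kinds, the evident square commutes up to pointwise identification (its homotopy $\prod_x(\cdots=\cdots)$ is inhabited crisply): * in 1, for $f::A'\to A$ and $g::B\to B'$, acting by $\flat$ of $k\mapsto g\circ k\circ\flat f$ on the left and of $k\mapsto\sharp g\circ k\circ f$ on the right; * in 2, for $f::A'\to A$ and $g::\prod_{x:A'}\bigl(B(f(x))\to B'(x)\bigr)$, acting by $\flat$ of $k\mapsto\lambda u.\,\mathsf{let}\ x^\flat:=u\ \mathsf{in}\ g(x)\bigl(k(f(x)^\flat)\bigr)$ on the left and of $k\mapsto\lambda x.\,\bigl(g(x)(k(f(x))_\sharp)\bigr)^\sharp$ on the right; * in 3, for $f::A\to A'$, acting by $\sharp(\flat f)$ and $\sharp f$; * in 4, for $f::A\to A'$, acting by $\flat f$ and $\flat(\sharp f)$. -/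

import Mathlib

/-!  Spatial type theory, presented as a formal system: raw syntax with two sorts of variables
(crisp and cohesive), two-zone contexts `Δ | Γ`, and an inductively generated derivability
relation.  The fixed part of the theory has a cumulative hierarchy of Russell universes, `Π`, `Σ`,
identity types, function extensionality, `♯` and `♭`.  All other type formers and axioms
(W-types, higher inductive types, univalence, ...) enter through a signature of further operators
and a set of further rules, both arbitrary. -/

namespace SpatialTT

/-- Further operators of the type theory.  The `i`-th argument of an operator `o` binds
`crispBinders o i` crisp variables and `binders o i` cohesive variables. -/
structure Signature where
  Op : Type
  arity : Op → ℕ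
  crispBinders : (o : Op) → Fin (arity o) → ℕ
  binders : (o : Op) → Fin (arity o) → ℕ

/-- Raw terms (types are terms).  Crisp and cohesive variables are two separate families of
de Bruijn indices. -/
inductive Tm (S : Signature) : Type
  | cvar (i : ℕ)  -- the `i`-th crisp variable
  | var (i : ℕ)  -- the `i`-th cohesive variable
  | univ (l : ℕ)  -- the universe `Type_l`
  | pi (A B : Tm S)  -- `Π (x : A), B`; binds one cohesive variable in `B`
  | lam (A b : Tm S)  -- `λ (x : A), b`; binds one cohesive variable in `b`
  | app (f a : Tm S)
  | sigma (A B : Tm S)  -- `Σ (x : A), B`; binds one cohesive variable in `B`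
  | pair (a b : Tm S)
  | sigmaInd (C d p : Tm S)  -- binds one cohesive variable in `C` and two in `d`
  | id (A a b : Tm S)  -- the identity type `a =_A b`
  | refl (a : Tm S)
  | idInd (C d a b p : Tm S)  -- binds three cohesive variables in `C` and one in `d`
  | funext (f g h : Tm S)
  | sharp (A : Tm S)  -- `♯ A`
  | sharpI (a : Tm S)  -- `a^♯`
  | sharpE (a : Tm S)  -- `a_♯`
  | flat (A : Tm S)  -- `♭ A`
  | flatI (a : Tm S)  -- `a^♭`
  | flatE (C M N : Tm S)  -- `let u^♭ := M in N`; binds one cohesive variable in the motive `C`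
                          -- and one crisp variable in `N`
  | op (o : S.Op) (args : Fin (S.arity o) → Tm S)

variable {S : Signature}

/-- Lifting of a renaming under a binder. -/
def liftRen (ρ : ℕ → ℕ) : ℕ → ℕ
  | 0 => 0
  | n + 1 => ρ n + 1

namespace Tm

/-- Renaming of the crisp variables by `ρ` and of the cohesive variables by `τ`. -/
def ren (ρ τ : ℕ → ℕ) : Tm S → Tm S
  | cvar i => cvar (ρ i)
  | var i => var (τ i)
  | univ l => univ l
  | pi A B => pi (A.ren ρ τ) (B.ren ρ (liftRen τ))
  | lam A b => lam (A.ren ρ τ) (b.ren ρ (liftRen τ))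
  | app f a => app (f.ren ρ τ) (a.ren ρ τ)
  | sigma A B => sigma (A.ren ρ τ) (B.ren ρ (liftRen τ))
  | pair a b => pair (a.ren ρ τ) (b.ren ρ τ)
  | sigmaInd C d p =>
      sigmaInd (C.ren ρ (liftRen τ)) (d.ren ρ (liftRen (liftRen τ))) (p.ren ρ τ)
  | id A a b => id (A.ren ρ τ) (a.ren ρ τ) (b.ren ρ τ)
  | refl a => refl (a.ren ρ τ)
  | idInd C d a b p =>
      idInd (C.ren ρ (liftRen (liftRen (liftRen τ)))) (d.ren ρ (liftRen τ))
        (a.ren ρ τ) (b.ren ρ τ) (p.ren ρ τ)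
  | funext f g h => funext (f.ren ρ τ) (g.ren ρ τ) (h.ren ρ τ)
  | sharp A => sharp (A.ren ρ τ)
  | sharpI a => sharpI (a.ren ρ τ)
  | sharpE a => sharpE (a.ren ρ τ)
  | flat A => flat (A.ren ρ τ)
  | flatI a => flatI (a.ren ρ τ)
  | flatE C M N => flatE (C.ren ρ (liftRen τ)) (M.ren ρ τ) (N.ren (liftRen ρ) τ)
  | op o args =>
      op o fun i => (args i).ren (liftRen^[S.crispBinders o i] ρ) (liftRen^[S.binders o i] τ)

/-- Weakening by `n` further crisp variables. -/
def cwkn (n : ℕ) (t : Tm S) : Tm S := t.ren (· + n) (fun i => i)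

/-- Weakening by `n` further cohesive variables. -/
def wkn (n : ℕ) (t : Tm S) : Tm S := t.ren (fun i => i) (· + n)

/-- Weakening by one crisp variable. -/
abbrev cwk (t : Tm S) : Tm S := t.cwkn 1

/-- Weakening by one cohesive variable. -/
abbrev wk (t : Tm S) : Tm S := t.wkn 1

end Tm

/-- A simultaneous substitution for the crisp and for the cohesive variables. -/
structure Sub (S : Signature) where
  crisp : ℕ → Tm S
  coh : ℕ → Tm S

namespace Sub

/-- Lifting of a substitution under a binder of a cohesive variable. -/
def up (s : Sub S) : Sub S where
  crisp i := (s.crisp i).wk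
  coh
    | 0 => .var 0
    | j + 1 => (s.coh j).wk

/-- Lifting of a substitution under a binder of a crisp variable. -/
def cup (s : Sub S) : Sub S where
  crisp
    | 0 => .cvar 0
    | i + 1 => (s.crisp i).cwk
  coh j := (s.coh j).cwk

end Sub

namespace Tm

/-- Capture-avoiding simultaneous substitution. -/
def subst (s : Sub S) : Tm S → Tm S
  | cvar i => s.crisp i
  | var i => s.coh i
  | univ l => univ l
  | pi A B => pi (A.subst s) (B.subst s.up)
  | lam A b => lam (A.subst s) (b.subst s.up)
  | app f a => app (f.subst s) (a.subst s)
  | sigma A B => sigma (A.subst s) (B.subst s.up)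
  | pair a b => pair (a.subst s) (b.subst s)
  | sigmaInd C d p => sigmaInd (C.subst s.up) (d.subst s.up.up) (p.subst s)
  | id A a b => id (A.subst s) (a.subst s) (b.subst s)
  | refl a => refl (a.subst s)
  | idInd C d a b p =>
      idInd (C.subst s.up.up.up) (d.subst s.up) (a.subst s) (b.subst s) (p.subst s)
  | funext f g h => funext (f.subst s) (g.subst s) (h.subst s)
  | sharp A => sharp (A.subst s)
  | sharpI a => sharpI (a.subst s)
  | sharpE a => sharpE (a.subst s)
  | flat A => flat (A.subst s)
  | flatI a => flatI (a.subst s)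
  | flatE C M N => flatE (C.subst s.up) (M.subst s) (N.subst s.cup)
  | op o args =>
      op o fun i => (args i).subst (Sub.cup^[S.crispBinders o i] (Sub.up^[S.binders o i] s))

/-- `t[a/x]` for the last cohesive variable `x`. -/
def inst (t a : Tm S) : Tm S :=
  t.subst ⟨cvar, fun | 0 => a | j + 1 => var j⟩

/-- `t[a/x, b/y]` for the last two cohesive variables `x, y`. -/
def inst₂ (t a b : Tm S) : Tm S :=
  t.subst ⟨cvar, fun | 0 => b | 1 => a | j + 2 => var j⟩

/-- `t[a/x, b/y, c/z]` for the last three cohesive variables `x, y, z`. -/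
def inst₃ (t a b c : Tm S) : Tm S :=
  t.subst ⟨cvar, fun | 0 => c | 1 => b | 2 => a | j + 3 => var j⟩

/-- `t[a/u]` for the last crisp variable `u`. -/
def cinst (t a : Tm S) : Tm S :=
  t.subst ⟨fun | 0 => a | i + 1 => cvar i, var⟩

/-- `t[a/u, b/v]` for the last two crisp variables `u, v`. -/
def cinst₂ (t a b : Tm S) : Tm S :=
  t.subst ⟨fun | 0 => b | 1 => a | i + 2 => cvar i, var⟩

/-- A term over `Δ | Γ`, with `Γ` of length `n`, read as a term over `Δ, Γ | ·`. -/
def crispify (n : ℕ) (t : Tm S) : Tm S :=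
  t.subst ⟨fun i => cvar (i + n), fun j => if j < n then cvar j else var (j - n)⟩

/-- For `C` over `Γ, x : ♭ A`: the type `C[u^♭/x]` over the contexts extended by a crisp
variable `u` in place of `x`. -/
def instFlatVar (C : Tm S) : Tm S := C.cwk.inst (flatI (cvar 0))

/-- For `C` over `Γ, z : Σ (x : A), B`: the type `C[(x, y)/z]` over `Γ, x : A, y : B`. -/
def instPairVar (C : Tm S) : Tm S :=
  C.subst ⟨cvar, fun | 0 => pair (var 1) (var 0) | j + 1 => var (j + 2)⟩

/-- For `C` over `Γ, x : A, y : A, p : x = y`: the type `C[z/x, z/y, refl_z/p]` over `Γ, z : A`. -/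
def instReflVar (C : Tm S) : Tm S :=
  C.subst ⟨cvar, fun | 0 => refl (var 0) | 1 => var 0 | 2 => var 0 | j + 3 => var (j + 1)⟩

/-- The non-dependent function type. -/
def arrow (A B : Tm S) : Tm S := pi A B.wk

end Tm

/-- One zone of a context: a list of types, with the last variable at the head. -/
abbrev Zone (S : Signature) := List (Tm S)

/-- The crisp context `Δ, Γ` obtained from `Δ | Γ` by making all variables crisp. -/
def Zone.join (Δ : Zone S) : Zone S → Zone S
  | [] => Δ
  | A :: Γ => A.crispify Γ.length :: Zone.join Δ Γ

/-- The cohesive context `Γ` after extending the crisp context by one variable. -/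
def Zone.cwk (Γ : Zone S) : Zone S := Γ.map Tm.cwk

/-- The judgments of spatial type theory, in the context `Δ | Γ`. -/
inductive Judgment (S : Signature) : Type
  | ctx (Δ Γ : Zone S)  -- `Δ | Γ` is a context
  | ty (Δ Γ : Zone S) (a A : Tm S)  -- `Δ | Γ ⊢ a : A`
  | eq (Δ Γ : Zone S) (a b A : Tm S)  -- `Δ | Γ ⊢ a ≡ b : A`

open Tm Judgment

/-- Derivability from the rules of spatial type theory together with the further rules `R`
(a rule being a list of premises and a conclusion). -/
inductive Derivable (R : Set (List (Judgment S) × Judgment S)) : Judgment S → Prop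
  -- contexts, variables, substitution
  | ctx_nil : Derivable R (ctx [] [])
  | ctx_crisp {Δ A l} : Derivable R (ctx Δ []) → Derivable R (ty Δ [] A (univ l)) →
      Derivable R (ctx (A :: Δ) [])
  | ctx_coh {Δ Γ A l} : Derivable R (ctx Δ Γ) → Derivable R (ty Δ Γ A (univ l)) →
      Derivable R (ctx Δ (A :: Γ))
  | ty_cvar {Δ Γ i A} : Derivable R (ctx Δ Γ) → Δ[i]? = some A →
      Derivable R (ty Δ Γ (cvar i) (A.cwkn (i + 1)))
  | ty_var {Δ Γ j A} : Derivable R (ctx Δ Γ) → Γ[j]? = some A →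
      Derivable R (ty Δ Γ (var j) (A.wkn (j + 1)))
  | subst_ty {Δ Γ Δ' Γ' a A} (s : Sub S) : Derivable R (ctx Δ' Γ') →
      (∀ i B, Δ[i]? = some B →
        Derivable R (ty Δ' [] (s.crisp i) ((B.cwkn (i + 1)).subst s))) →
      (∀ j B, Γ[j]? = some B →
        Derivable R (ty Δ' Γ' (s.coh j) ((B.wkn (j + 1)).subst s))) →
      Derivable R (ty Δ Γ a A) → Derivable R (ty Δ' Γ' (a.subst s) (A.subst s))
  | subst_eq {Δ Γ Δ' Γ' a b A} (s : Sub S) : Derivable R (ctx Δ' Γ') →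
      (∀ i B, Δ[i]? = some B →
        Derivable R (ty Δ' [] (s.crisp i) ((B.cwkn (i + 1)).subst s))) →
      (∀ j B, Γ[j]? = some B →
        Derivable R (ty Δ' Γ' (s.coh j) ((B.wkn (j + 1)).subst s))) →
      Derivable R (eq Δ Γ a b A) →
      Derivable R (eq Δ' Γ' (a.subst s) (b.subst s) (A.subst s))
  -- judgmental equality
  | eq_refl {Δ Γ a A} : Derivable R (ty Δ Γ a A) → Derivable R (eq Δ Γ a a A)
  | eq_symm {Δ Γ a b A} : Derivable R (eq Δ Γ a b A) → Derivable R (eq Δ Γ b a A)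
  | eq_trans {Δ Γ a b c A} : Derivable R (eq Δ Γ a b A) → Derivable R (eq Δ Γ b c A) →
      Derivable R (eq Δ Γ a c A)
  | ty_conv {Δ Γ a A B l} : Derivable R (ty Δ Γ a A) → Derivable R (eq Δ Γ A B (univ l)) →
      Derivable R (ty Δ Γ a B)
  | eq_conv {Δ Γ a b A B l} : Derivable R (eq Δ Γ a b A) → Derivable R (eq Δ Γ A B (univ l)) →
      Derivable R (eq Δ Γ a b B)
  -- universes
  | univ_ty {Δ Γ l} : Derivable R (ctx Δ Γ) → Derivable R (ty Δ Γ (univ l) (univ (l + 1)))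
  | cumul_ty {Δ Γ A l} : Derivable R (ty Δ Γ A (univ l)) →
      Derivable R (ty Δ Γ A (univ (l + 1)))
  | cumul_eq {Δ Γ A B l} : Derivable R (eq Δ Γ A B (univ l)) →
      Derivable R (eq Δ Γ A B (univ (l + 1)))
  -- `Π`-types
  | pi_form {Δ Γ A B l} : Derivable R (ty Δ Γ A (univ l)) →
      Derivable R (ty Δ (A :: Γ) B (univ l)) → Derivable R (ty Δ Γ (pi A B) (univ l))
  | pi_intro {Δ Γ A B b} : Derivable R (ty Δ (A :: Γ) b B) →
      Derivable R (ty Δ Γ (lam A b) (pi A B))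
  | pi_elim {Δ Γ A B f a} : Derivable R (ty Δ Γ f (pi A B)) → Derivable R (ty Δ Γ a A) →
      Derivable R (ty Δ Γ (app f a) (B.inst a))
  | pi_beta {Δ Γ A B b a} : Derivable R (ty Δ (A :: Γ) b B) → Derivable R (ty Δ Γ a A) →
      Derivable R (eq Δ Γ (app (lam A b) a) (b.inst a) (B.inst a))
  | pi_eta {Δ Γ A B f} : Derivable R (ty Δ Γ f (pi A B)) →
      Derivable R (eq Δ Γ f (lam A (app f.wk (var 0))) (pi A B))
  | pi_form_eq {Δ Γ A A' B B' l} : Derivable R (eq Δ Γ A A' (univ l)) →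
      Derivable R (eq Δ (A :: Γ) B B' (univ l)) →
      Derivable R (eq Δ Γ (pi A B) (pi A' B') (univ l))
  | pi_intro_eq {Δ Γ A A' B b b' l} : Derivable R (eq Δ Γ A A' (univ l)) →
      Derivable R (eq Δ (A :: Γ) b b' B) →
      Derivable R (eq Δ Γ (lam A b) (lam A' b') (pi A B))
  | pi_elim_eq {Δ Γ A B f f' a a'} : Derivable R (eq Δ Γ f f' (pi A B)) →
      Derivable R (eq Δ Γ a a' A) → Derivable R (eq Δ Γ (app f a) (app f' a') (B.inst a))
  -- `Σ`-types
  | sigma_form {Δ Γ A B l} : Derivable R (ty Δ Γ A (univ l)) →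
      Derivable R (ty Δ (A :: Γ) B (univ l)) → Derivable R (ty Δ Γ (sigma A B) (univ l))
  | sigma_intro {Δ Γ A B a b l} : Derivable R (ty Δ (A :: Γ) B (univ l)) →
      Derivable R (ty Δ Γ a A) → Derivable R (ty Δ Γ b (B.inst a)) →
      Derivable R (ty Δ Γ (pair a b) (sigma A B))
  | sigma_elim {Δ Γ A B C d p l} : Derivable R (ty Δ (sigma A B :: Γ) C (univ l)) →
      Derivable R (ty Δ (B :: A :: Γ) d C.instPairVar) → Derivable R (ty Δ Γ p (sigma A B)) →
      Derivable R (ty Δ Γ (sigmaInd C d p) (C.inst p))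
  | sigma_beta {Δ Γ A B C d a b l} : Derivable R (ty Δ (sigma A B :: Γ) C (univ l)) →
      Derivable R (ty Δ (B :: A :: Γ) d C.instPairVar) →
      Derivable R (ty Δ Γ a A) → Derivable R (ty Δ Γ b (B.inst a)) →
      Derivable R (eq Δ Γ (sigmaInd C d (pair a b)) (d.inst₂ a b) (C.inst (pair a b)))
  | sigma_form_eq {Δ Γ A A' B B' l} : Derivable R (eq Δ Γ A A' (univ l)) →
      Derivable R (eq Δ (A :: Γ) B B' (univ l)) →
      Derivable R (eq Δ Γ (sigma A B) (sigma A' B') (univ l))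
  | sigma_intro_eq {Δ Γ A B a a' b b' l} : Derivable R (ty Δ (A :: Γ) B (univ l)) →
      Derivable R (eq Δ Γ a a' A) → Derivable R (eq Δ Γ b b' (B.inst a)) →
      Derivable R (eq Δ Γ (pair a b) (pair a' b') (sigma A B))
  | sigma_elim_eq {Δ Γ A B C C' d d' p p' l} :
      Derivable R (eq Δ (sigma A B :: Γ) C C' (univ l)) →
      Derivable R (eq Δ (B :: A :: Γ) d d' C.instPairVar) →
      Derivable R (eq Δ Γ p p' (sigma A B)) →
      Derivable R (eq Δ Γ (sigmaInd C d p) (sigmaInd C' d' p') (C.inst p))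
  -- identity types
  | id_form {Δ Γ A a b l} : Derivable R (ty Δ Γ A (univ l)) → Derivable R (ty Δ Γ a A) →
      Derivable R (ty Δ Γ b A) → Derivable R (ty Δ Γ (id A a b) (univ l))
  | id_intro {Δ Γ A a} : Derivable R (ty Δ Γ a A) →
      Derivable R (ty Δ Γ (refl a) (id A a a))
  | id_elim {Δ Γ A C d a b p l} :
      Derivable R (ty Δ (id (A.wkn 2) (var 1) (var 0) :: A.wk :: A :: Γ) C (univ l)) →
      Derivable R (ty Δ (A :: Γ) d C.instReflVar) →
      Derivable R (ty Δ Γ a A) → Derivable R (ty Δ Γ b A) → Derivable R (ty Δ Γ p (id A a b)) →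
      Derivable R (ty Δ Γ (idInd C d a b p) (C.inst₃ a b p))
  | id_beta {Δ Γ A C d a l} :
      Derivable R (ty Δ (id (A.wkn 2) (var 1) (var 0) :: A.wk :: A :: Γ) C (univ l)) →
      Derivable R (ty Δ (A :: Γ) d C.instReflVar) → Derivable R (ty Δ Γ a A) →
      Derivable R (eq Δ Γ (idInd C d a a (refl a)) (d.inst a) (C.inst₃ a a (refl a)))
  | id_form_eq {Δ Γ A A' a a' b b' l} : Derivable R (eq Δ Γ A A' (univ l)) →
      Derivable R (eq Δ Γ a a' A) → Derivable R (eq Δ Γ b b' A) →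
      Derivable R (eq Δ Γ (id A a b) (id A' a' b') (univ l))
  | id_intro_eq {Δ Γ A a a'} : Derivable R (eq Δ Γ a a' A) →
      Derivable R (eq Δ Γ (refl a) (refl a') (id A a a))
  | id_elim_eq {Δ Γ A C C' d d' a a' b b' p p' l} :
      Derivable R (eq Δ (id (A.wkn 2) (var 1) (var 0) :: A.wk :: A :: Γ) C C' (univ l)) →
      Derivable R (eq Δ (A :: Γ) d d' C.instReflVar) →
      Derivable R (eq Δ Γ a a' A) → Derivable R (eq Δ Γ b b' A) →
      Derivable R (eq Δ Γ p p' (id A a b)) →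
      Derivable R (eq Δ Γ (idInd C d a b p) (idInd C' d' a' b' p') (C.inst₃ a b p))
  -- function extensionality
  | funext_intro {Δ Γ A B f g h} :
      Derivable R (ty Δ Γ f (pi A B)) → Derivable R (ty Δ Γ g (pi A B)) →
      Derivable R (ty Δ Γ h (pi A (id B (app f.wk (var 0)) (app g.wk (var 0))))) →
      Derivable R (ty Δ Γ (funext f g h) (id (pi A B) f g))
  | funext_intro_eq {Δ Γ A B f f' g g' h h'} :
      Derivable R (eq Δ Γ f f' (pi A B)) → Derivable R (eq Δ Γ g g' (pi A B)) →
      Derivable R (eq Δ Γ h h' (pi A (id B (app f.wk (var 0)) (app g.wk (var 0))))) →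
      Derivable R (eq Δ Γ (funext f g h) (funext f' g' h') (id (pi A B) f g))
  -- `♯`
  | sharp_form {Δ Γ A l} :
      Derivable R (ty (Zone.join Δ Γ) [] (A.crispify Γ.length) (univ l)) →
      Derivable R (ty Δ Γ (sharp A) (univ l))
  | sharp_intro {Δ Γ M A} :
      Derivable R (ty (Zone.join Δ Γ) [] (M.crispify Γ.length) (A.crispify Γ.length)) →
      Derivable R (ty Δ Γ (sharpI M) (sharp A))
  | sharp_elim {Δ Γ M A} : Derivable R (ctx Δ Γ) → Derivable R (ty Δ [] M (sharp A)) →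
      Derivable R (ty Δ Γ (sharpE M) A)
  | sharp_beta {Δ Γ M A} : Derivable R (ctx Δ Γ) → Derivable R (ty Δ [] M A) →
      Derivable R (eq Δ Γ (sharpE (sharpI M)) M A)
  | sharp_eta {Δ Γ M A} : Derivable R (ty Δ Γ M (sharp A)) →
      Derivable R (eq Δ Γ (sharpI (sharpE M)) M (sharp A))
  | sharp_form_eq {Δ Γ A A' l} :
      Derivable R (eq (Zone.join Δ Γ) [] (A.crispify Γ.length) (A'.crispify Γ.length) (univ l)) →
      Derivable R (eq Δ Γ (sharp A) (sharp A') (univ l))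
  | sharp_intro_eq {Δ Γ M M' A} :
      Derivable R (eq (Zone.join Δ Γ) [] (M.crispify Γ.length) (M'.crispify Γ.length)
        (A.crispify Γ.length)) →
      Derivable R (eq Δ Γ (sharpI M) (sharpI M') (sharp A))
  | sharp_elim_eq {Δ Γ M M' A} : Derivable R (ctx Δ Γ) →
      Derivable R (eq Δ [] M M' (sharp A)) → Derivable R (eq Δ Γ (sharpE M) (sharpE M') A)
  -- `♭`
  | flat_form {Δ Γ A l} : Derivable R (ctx Δ Γ) → Derivable R (ty Δ [] A (univ l)) →
      Derivable R (ty Δ Γ (flat A) (univ l))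
  | flat_intro {Δ Γ M A} : Derivable R (ctx Δ Γ) → Derivable R (ty Δ [] M A) →
      Derivable R (ty Δ Γ (flatI M) (flat A))
  | flat_elim {Δ Γ A C M N l} : Derivable R (ty Δ (flat A :: Γ) C (univ l)) →
      Derivable R (ty Δ Γ M (flat A)) →
      Derivable R (ty (A :: Δ) (Zone.cwk Γ) N C.instFlatVar) →
      Derivable R (ty Δ Γ (flatE C M N) (C.inst M))
  | flat_beta {Δ Γ A C M N l} : Derivable R (ty Δ (flat A :: Γ) C (univ l)) →
      Derivable R (ty Δ [] M A) →
      Derivable R (ty (A :: Δ) (Zone.cwk Γ) N C.instFlatVar) →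
      Derivable R (eq Δ Γ (flatE C (flatI M) N) (N.cinst M) (C.inst (flatI M)))
  | flat_form_eq {Δ Γ A A' l} : Derivable R (ctx Δ Γ) → Derivable R (eq Δ [] A A' (univ l)) →
      Derivable R (eq Δ Γ (flat A) (flat A') (univ l))
  | flat_intro_eq {Δ Γ M M' A} : Derivable R (ctx Δ Γ) → Derivable R (eq Δ [] M M' A) →
      Derivable R (eq Δ Γ (flatI M) (flatI M') (flat A))
  | flat_elim_eq {Δ Γ A C C' M M' N N' l} :
      Derivable R (eq Δ (flat A :: Γ) C C' (univ l)) →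
      Derivable R (eq Δ Γ M M' (flat A)) →
      Derivable R (eq (A :: Δ) (Zone.cwk Γ) N N' C.instFlatVar) →
      Derivable R (eq Δ Γ (flatE C M N) (flatE C' M' N') (C.inst M))
  -- further rules
  | rule {premises : List (Judgment S)} {J : Judgment S} : (premises, J) ∈ R →
      (∀ P ∈ premises, Derivable R P) → Derivable R J

namespace Tm

/-- The type `isequiv f`, for `f : X → Y`, that `f` has a right inverse and a left inverse. -/
def isEquiv (X Y f : Tm S) : Tm S :=
  sigma
    (sigma (arrow Y X)
      (pi Y.wk (id (Y.wkn 2) (app (f.wkn 2) (app (var 1) (var 0))) (var 0))))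
    (wk (sigma (arrow Y X)
      (pi X.wk (id (X.wkn 2) (app (var 1) (app (f.wkn 2) (var 0))) (var 0)))))

/-- The counit `a_♭`, that is `let u^♭ := a in u`, for crisp `A` and `a : ♭ A`. -/
def counit (A a : Tm S) : Tm S := flatE A.wk a (cvar 0)

/-- The functorial action `♭ f : ♭ X → ♭ Y`, `x ↦ let u^♭ := x in (f u)^♭`, of a crisp
`f : X → Y`. -/
def flatMap (X Y f : Tm S) : Tm S :=
  lam (flat X) (flatE (flat (Y.wkn 2)) (var 0) (flatI (app f.wk.cwk (cvar 0))))

/-- The functorial action `♯ f : ♯ X → ♯ Y`, `x ↦ (f x_♯)^♯`, of `f : X → Y`. -/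
def sharpMap (X f : Tm S) : Tm S :=
  lam (sharp X) (sharpI (app f.wk (sharpE (var 0))))

/-- The map `(A → B) → (A' → B')`, `k ↦ λ x, g (k (f x))`, for `f : A' → A` and `g : B → B'`. -/
def homMap (A B A' f g : Tm S) : Tm S :=
  lam (arrow A B) (lam A'.wk (app (g.wkn 2) (app (var 1) (app (f.wkn 2) (var 0)))))

/-- The type `Π (u : ♭ A), B (u_♭)` for crisp `A` and `B : A → Type`. -/
def piCounit (A B : Tm S) : Tm S := pi (flat A) (app B.wk (counit A.wk (var 0)))

/-- The type `Π (x : A), ♯ (B x)` for `B : A → Type`. -/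
def piSharp (A B : Tm S) : Tm S := pi A (sharp (app B.wk (var 0)))

/-- For crisp `f : A' → A` and `g : Π (x : A'), B (f x) → B' x`, the map
`(Π (u : ♭ A), B (u_♭)) → (Π (u : ♭ A'), B' (u_♭))`,
`k ↦ λ u, let x^♭ := u in g x (k ((f x)^♭))`. -/
def piCounitMap (A B A' B' f g : Tm S) : Tm S :=
  lam (piCounit A B) (lam (flat A'.wk)
    (flatE (app (B'.wkn 3) (counit (A'.wkn 3) (var 0))) (var 0)
      (app (app (g.wkn 2).cwk (cvar 0))
        (app (var 1) (flatI (app (f.wkn 2).cwk (cvar 0)))))))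

/-- For `f : A' → A` and `g : Π (x : A'), B (f x) → B' x`, the map
`(Π (x : A), ♯ (B x)) → (Π (x : A'), ♯ (B' x))`, `k ↦ λ x, (g x (k (f x))_♯)^♯`. -/
def piSharpMap (A B A' f g : Tm S) : Tm S :=
  lam (piSharp A B) (lam A'.wk
    (sharpI (app (app (g.wkn 2) (var 0)) (sharpE (app (var 1) (app (f.wkn 2) (var 0)))))))

end Tm

/-- `Δ` is a crisp context. -/
def IsCrispCtx (R : Set (List (Judgment S) × Judgment S)) (Δ : Zone S) : Prop :=
  Derivable R (ctx Δ [])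

/-- `Δ | · ⊢ a : A`, i.e. `a :: A` over the crisp context `Δ`. -/
def Crisp (R : Set (List (Judgment S) × Judgment S)) (Δ : Zone S) (a A : Tm S) : Prop :=
  Derivable R (ty Δ [] a A)

/-- `φ :: X → Y` is (crisply) an equivalence: `isequiv φ` has an element. -/
def IsCrispEquivalence (R : Set (List (Judgment S) × Judgment S)) (Δ : Zone S)
    (X Y φ : Tm S) : Prop :=
  Crisp R Δ φ (arrow X Y) ∧ ∃ w, Crisp R Δ w (isEquiv X Y φ)

/-- The square with sides `φ : X → Y`, `φ' : X' → Y'`, `p : X → X'`, `q : Y → Y'` commutes: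
`Π (x : X), φ' (p x) = q (φ x)` has an element. -/
def CommutesCrisply (R : Set (List (Judgment S) × Judgment S)) (Δ : Zone S)
    (X Y' φ φ' p q : Tm S) : Prop :=
  ∃ w, Crisp R Δ w (pi X (id Y'.wk (app φ'.wk (app p.wk (var 0))) (app q.wk (app φ.wk (var 0)))))

end SpatialTT

namespace SpatialTT

variable {S : Signature} {R : Set (List (Judgment S) × Judgment S)}

open Tm Judgment

/-! ### Renaming and substitution -/

/-! Everything is decided at crisp points. By the elimination rule of `♭`, a homotopy between
functions out of `♭ X` need only be given at `u^♭` for a crisp variable `u :: X`, and there `let`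
computes. So a map `♭ X → ♭ Y` is described by a crisp term `t(u) : Y`. It is an equivalence as soon
as there is `r(v) : X` with `(r(t(u)))^♭ = u^♭` and `(t(r(v)))^♭ = v^♭` (`letFlat_isEquiv`), and a
square of such maps commutes as soon as the terms agree judgmentally (`letFlat_square`).

For `♭ A ≃ ♭ ♯ A` the terms are `u^♯` and `v_♯`, inverse by the `β` and `η` rules of `♯`. For the
two statements on functions they are `λ x, (k (x^♭))^♯` and `λ u, let x^♭ := u in (h x)_♯`. One
composite is judgmentally the identity; the other is identified with it by `♭`-induction and
function extensionality, and this crisp identification is then carried under `♭` (`flat_ap`). The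
Boolean in `fam` treats both statements at once: the non-dependent one is not literally the
dependent one at a constant family, whose values are only judgmentally equal to `B`.

For `♯ ♭ A ≃ ♯ A` the inverse is `y ↦ ((y_♯)^♭)^♯`. On `♯ ♭ A` the composite does not compute,
because `x_♯`, though crisp under `♯`, is not of the form `u^♭`. Two functions `♭ A → ♯ ♭ A` are
compared by `♭`-induction instead, and the homotopy is extended to `♯ ♭ A` by `sharp_ext`.
Naturality of this equivalence is proved in the same way.

The theory has no rule of induction over crisp identifications. `flat_ap` and `sharp_ext` replace it
by ordinary path induction with a motive built with `♯`, under which the cohesive variables of the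
motive become crisp.

The further rules `R` are arbitrary, so induction on derivations gives no control over them; in
particular a term derivable over a crisp context need not be syntactically free of cohesive
variables. Derivations are therefore built over contexts whose entries are written with crisp
variables only, where this freeness (`CohClosed`) can be checked, and are moved to arbitrary `A`,
`B`, `f`, `g` by the substitution rule (`TypedSub`). -/

theorem Sub.ext' {s t : Sub S} (h : ∀ i, s.crisp i = t.crisp i) (h' : ∀ j, s.coh j = t.coh j) :
    s = t := by
  cases s; cases t
  simp only [Sub.mk.injEq]
  exact ⟨funext h, funext h'⟩

/-- Precomposition of a substitution with a renaming. -/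
def Sub.pre (ρ τ : ℕ → ℕ) (s : Sub S) : Sub S := ⟨fun i => s.crisp (ρ i), fun j => s.coh (τ j)⟩

theorem Sub.pre_up (ρ τ : ℕ → ℕ) (s : Sub S) :
    Sub.pre ρ (liftRen τ) s.up = (Sub.pre ρ τ s).up :=
  Sub.ext' (fun _ => rfl) (fun j => by cases j <;> rfl)

theorem Sub.pre_cup (ρ τ : ℕ → ℕ) (s : Sub S) :
    Sub.pre (liftRen ρ) τ s.cup = (Sub.pre ρ τ s).cup :=
  Sub.ext' (fun i => by cases i <;> rfl) (fun _ => rfl)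

theorem Sub.pre_up_iterate (ρ τ : ℕ → ℕ) (n : ℕ) (s : Sub S) :
    Sub.pre ρ (liftRen^[n] τ) (Sub.up^[n] s) = Sub.up^[n] (Sub.pre ρ τ s) := by
  induction n generalizing τ s with
  | zero => rfl
  | succ n ih => simp only [Function.iterate_succ, Function.comp, ih, Sub.pre_up]

theorem Sub.pre_cup_iterate (ρ τ : ℕ → ℕ) (n : ℕ) (s : Sub S) :
    Sub.pre (liftRen^[n] ρ) τ (Sub.cup^[n] s) = Sub.cup^[n] (Sub.pre ρ τ s) := by
  induction n generalizing ρ s with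
  | zero => rfl
  | succ n ih => simp only [Function.iterate_succ, Function.comp, ih, Sub.pre_cup]

theorem Tm.ren_subst (t : Tm S) (ρ τ : ℕ → ℕ) (s : Sub S) :
    (t.ren ρ τ).subst s = t.subst (s.pre ρ τ) := by
  induction t generalizing ρ τ s with
  | cvar | var => rfl
  | op o args ih =>
    simp only [Tm.ren, Tm.subst, ih, Sub.pre_cup_iterate, Sub.pre_up_iterate]
  | _ => simp only [Tm.ren, Tm.subst, Sub.pre_up, Sub.pre_cup, *]

/-- The substitution of variables for variables. -/
def Sub.ofRen (ρ τ : ℕ → ℕ) : Sub S := ⟨fun i => cvar (ρ i), fun j => var (τ j)⟩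

theorem Sub.ofRen_up (ρ τ : ℕ → ℕ) : (Sub.ofRen ρ τ : Sub S).up = Sub.ofRen ρ (liftRen τ) :=
  Sub.ext' (fun _ => rfl) (fun j => by cases j <;> rfl)

theorem Sub.ofRen_cup (ρ τ : ℕ → ℕ) : (Sub.ofRen ρ τ : Sub S).cup = Sub.ofRen (liftRen ρ) τ :=
  Sub.ext' (fun i => by cases i <;> rfl) (fun _ => rfl)

theorem Sub.ofRen_up_iterate (ρ τ : ℕ → ℕ) (n : ℕ) :
    Sub.up^[n] (Sub.ofRen ρ τ : Sub S) = Sub.ofRen ρ (liftRen^[n] τ) := by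
  induction n generalizing τ with
  | zero => rfl
  | succ n ih => simp only [Function.iterate_succ, Function.comp, ih, Sub.ofRen_up]

theorem Sub.ofRen_cup_iterate (ρ τ : ℕ → ℕ) (n : ℕ) :
    Sub.cup^[n] (Sub.ofRen ρ τ : Sub S) = Sub.ofRen (liftRen^[n] ρ) τ := by
  induction n generalizing ρ with
  | zero => rfl
  | succ n ih => simp only [Function.iterate_succ, Function.comp, ih, Sub.ofRen_cup]

theorem Tm.subst_ofRen (t : Tm S) (ρ τ : ℕ → ℕ) : t.subst (Sub.ofRen ρ τ) = t.ren ρ τ := by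
  induction t generalizing ρ τ with
  | cvar | var => rfl
  | op o args ih =>
    simp only [Tm.ren, Tm.subst, ih, Sub.ofRen_up_iterate, Sub.ofRen_cup_iterate]
  | _ => simp only [Tm.ren, Tm.subst, Sub.ofRen_up, Sub.ofRen_cup, *]

theorem liftRen_id : liftRen (fun i => i) = fun i => i := by
  funext i; cases i <;> rfl

theorem Tm.ren_id (t : Tm S) : t.ren (fun i => i) (fun j => j) = t := by
  have h : ∀ n : ℕ, liftRen^[n] (fun i => i) = fun i => i := fun n => by
    induction n with
    | zero => rfl
    | succ n ih => simp only [Function.iterate_succ, Function.comp, liftRen_id, ih]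
  induction t with
  | cvar | var => rfl
  | op o args ih => simp only [Tm.ren, h, ih]
  | _ => simp only [Tm.ren, liftRen_id, *]

theorem Tm.subst_id (t : Tm S) : t.subst ⟨cvar, var⟩ = t :=
  (t.subst_ofRen (fun i => i) (fun j => j)).trans t.ren_id

theorem Tm.ren_ren (t : Tm S) (ρ τ ρ' τ' : ℕ → ℕ) :
    (t.ren ρ τ).ren ρ' τ' = t.ren (fun i => ρ' (ρ i)) (fun j => τ' (τ j)) := by
  rw [← Tm.subst_ofRen, Tm.ren_subst, ← Tm.subst_ofRen]; rfl

/-- Postcomposition of a substitution with a renaming. -/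
def Sub.post (ρ τ : ℕ → ℕ) (s : Sub S) : Sub S :=
  ⟨fun i => (s.crisp i).ren ρ τ, fun j => (s.coh j).ren ρ τ⟩

theorem Sub.post_up (ρ τ : ℕ → ℕ) (s : Sub S) :
    s.up.post ρ (liftRen τ) = (s.post ρ τ).up := by
  refine Sub.ext' (fun i => ?_) (fun j => ?_)
  · simp only [Sub.post, Sub.up, Tm.wk, Tm.wkn, Tm.ren_ren]; rfl
  · cases j with
    | zero => rfl
    | succ j => simp only [Sub.post, Sub.up, Tm.wk, Tm.wkn, Tm.ren_ren]; rfl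

theorem Sub.post_cup (ρ τ : ℕ → ℕ) (s : Sub S) :
    s.cup.post (liftRen ρ) τ = (s.post ρ τ).cup := by
  refine Sub.ext' (fun i => ?_) (fun j => ?_)
  · cases i with
    | zero => rfl
    | succ j => simp only [Sub.post, Sub.cup, Tm.cwk, Tm.cwkn, Tm.ren_ren]; rfl
  · simp only [Sub.post, Sub.cup, Tm.cwk, Tm.cwkn, Tm.ren_ren]; rfl

theorem Sub.post_up_iterate (ρ τ : ℕ → ℕ) (n : ℕ) (s : Sub S) :
    (Sub.up^[n] s).post ρ (liftRen^[n] τ) = Sub.up^[n] (s.post ρ τ) := by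
  induction n generalizing τ s with
  | zero => rfl
  | succ n ih => simp only [Function.iterate_succ, Function.comp, ih, Sub.post_up]

theorem Sub.post_cup_iterate (ρ τ : ℕ → ℕ) (n : ℕ) (s : Sub S) :
    (Sub.cup^[n] s).post (liftRen^[n] ρ) τ = Sub.cup^[n] (s.post ρ τ) := by
  induction n generalizing ρ s with
  | zero => rfl
  | succ n ih => simp only [Function.iterate_succ, Function.comp, ih, Sub.post_cup]

/-- With `ren_subst` and `ren_ren` this is all the substitution calculus that is required: one of
the two factors is always a renaming, and no lemma on composing two proper substitutions is needed.
-/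
theorem Tm.subst_ren (t : Tm S) (ρ τ : ℕ → ℕ) (s : Sub S) :
    (t.subst s).ren ρ τ = t.subst (s.post ρ τ) := by
  induction t generalizing ρ τ s with
  | cvar | var => rfl
  | op o args ih =>
    simp only [Tm.ren, Tm.subst, ih, Sub.post_cup_iterate, Sub.post_up_iterate]
  | _ => simp only [Tm.ren, Tm.subst, Sub.post_up, Sub.post_cup, *]

theorem Tm.wk_subst_up (t : Tm S) (s : Sub S) : t.wk.subst s.up = (t.subst s).wk := by
  rw [Tm.wk, Tm.wkn, Tm.wk, Tm.wkn, Tm.ren_subst, Tm.subst_ren]; rfl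

theorem Tm.cwk_subst_cup (t : Tm S) (s : Sub S) : t.cwk.subst s.cup = (t.subst s).cwk := by
  rw [Tm.cwk, Tm.cwkn, Tm.cwk, Tm.cwkn, Tm.ren_subst, Tm.subst_ren]; rfl

theorem Tm.wkn_two (t : Tm S) : t.wkn 2 = t.wk.wk := by
  simp only [Tm.wk, Tm.wkn, Tm.ren_ren]

theorem Tm.wkn_three (t : Tm S) : t.wkn 3 = t.wk.wk.wk := by
  simp only [Tm.wk, Tm.wkn, Tm.ren_ren]

theorem Tm.wk_inst (t a : Tm S) : t.wk.inst a = t := by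
  rw [Tm.wk, Tm.wkn, Tm.inst, Tm.ren_subst]; exact t.subst_id

theorem Tm.cwk_cinst (t a : Tm S) : t.cwk.cinst a = t := by
  rw [Tm.cwk, Tm.cwkn, Tm.cinst, Tm.ren_subst]; exact t.subst_id

/-! ### Terms without cohesive variables -/

/-- No cohesive variable occurs free in `t`. -/
def CohClosed (t : Tm S) : Prop := ∀ c τ τ', t.subst ⟨c, τ⟩ = t.subst ⟨c, τ'⟩

namespace CohClosed

variable {t : Tm S}

theorem subst_eq (h : CohClosed t) (τ : ℕ → Tm S) : t.subst ⟨cvar, τ⟩ = t :=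
  (h cvar τ var).trans t.subst_id

theorem subst_eq_cwkn (h : CohClosed t) (n : ℕ) (τ : ℕ → Tm S) :
    t.subst ⟨fun i => cvar (i + n), τ⟩ = t.cwkn n :=
  (h _ τ var).trans (t.subst_ofRen (· + n) (fun j => j))

theorem wk (h : CohClosed t) : t.wk = t :=
  (t.subst_ofRen (fun i => i) (· + 1)).symm.trans (h.subst_eq _)

theorem inst (h : CohClosed t) (a : Tm S) : t.inst a = t := h.subst_eq _

theorem crispify (h : CohClosed t) (n : ℕ) : t.crispify n = t.cwkn n := h.subst_eq_cwkn n _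

/-- This is where it matters that `CohClosed` quantifies over the crisp half of the substitution: a
renaming of crisp variables changes only that half. -/
theorem cwkn (h : CohClosed t) (n : ℕ) : CohClosed (t.cwkn n) := fun c τ τ' => by
  rw [Tm.cwkn, Tm.ren_subst, Tm.ren_subst]; exact h _ _ _

theorem instFlatVar (h : CohClosed t) : t.instFlatVar = t.cwk := (h.cwkn 1).inst _

theorem subst_up (h : CohClosed t) (τ : ℕ → Tm S) : t.subst (Sub.up ⟨cvar, τ⟩) = t :=
  h.subst_eq _

theorem subst_cup (h : CohClosed t) (τ : ℕ → Tm S) : t.subst (Sub.cup ⟨cvar, τ⟩) = t := by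
  have : (Sub.cup ⟨cvar, τ⟩ : Sub S) = ⟨cvar, fun j => (τ j).cwk⟩ :=
    Sub.ext' (fun i => by cases i <;> rfl) (fun _ => rfl)
  rw [this]; exact h.subst_eq _

end CohClosed

/-! ### Structural rules -/

/-- Used to check the premises of the substitution rule one variable at a time when the zone is an
explicit list. -/
theorem forall_getElem?_cons {α : Type*} {x : α} {L : List α} {P : ℕ → α → Prop} (h : P 0 x)
    (h' : ∀ i b, L[i]? = some b → P (i + 1) b) : ∀ i b, (x :: L)[i]? = some b → P i b
  | 0, b, e => by
    obtain rfl : x = b := by simpa using e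
    exact h
  | i + 1, b, e => h' i b (by simpa using e)

theorem forall_getElem?_nil {α : Type*} {P : ℕ → α → Prop} :
    ∀ i b, ([] : List α)[i]? = some b → P i b := fun i b e => by simp at e

/-- `Δ` is a crisp context in whose types no cohesive variable occurs. -/
structure ClosedCtx (R : Set (List (Judgment S) × Judgment S)) (Δ : Zone S) : Prop where
  ctx : Derivable R (ctx Δ [])
  closed : ∀ B ∈ Δ, CohClosed B

theorem ClosedCtx.cons {Δ : Zone S} {X : Tm S} {l : ℕ} (h : ClosedCtx R Δ)
    (hX : Derivable R (ty Δ [] X (univ l))) (hX' : CohClosed X) : ClosedCtx R (X :: Δ) :=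
  ⟨.ctx_crisp h.ctx hX, List.forall_mem_cons.2 ⟨hX', h.closed⟩⟩

theorem ClosedCtx.nil : ClosedCtx R [] := ⟨.ctx_nil, by simp⟩

namespace Derivable

variable {Δ Γ Γ' : Zone S} {a b A X : Tm S} {l : ℕ}

theorem ctx_cvar (h : Derivable R (ctx Δ Γ)) (i : ℕ) (B : Tm S)
    (e : Δ[i]? = some B) :
    Derivable R (ty Δ Γ (cvar i) ((B.cwkn (i + 1)).subst ⟨cvar, var⟩)) := by
  rw [Tm.subst_id]; exact ty_cvar h e

/-- The new variables are added at the outer end of the cohesive zone, so no de Bruijn index moves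
and the substitution rule applies with the identity. -/
theorem weaken (h : Derivable R (ctx Δ [])) (ha : Derivable R (ty Δ Γ a A))
    (h' : Derivable R (ctx Δ (Γ ++ Γ'))) : Derivable R (ty Δ (Γ ++ Γ') a A) := by
  rw [← a.subst_id, ← A.subst_id]
  refine subst_ty ⟨cvar, var⟩ h' (ctx_cvar h) (fun j B e => ?_) ha
  rw [Tm.subst_id]
  exact ty_var h' (List.getElem?_append_left (List.getElem?_eq_some_iff.1 e).1 ▸ e)

theorem weaken_eq (h : Derivable R (ctx Δ [])) (ha : Derivable R (eq Δ Γ a b A))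
    (h' : Derivable R (ctx Δ (Γ ++ Γ'))) : Derivable R (eq Δ (Γ ++ Γ') a b A) := by
  rw [← a.subst_id, ← b.subst_id, ← A.subst_id]
  refine subst_eq ⟨cvar, var⟩ h' (ctx_cvar h) (fun j B e => ?_) ha
  rw [Tm.subst_id]
  exact ty_var h' (List.getElem?_append_left (List.getElem?_eq_some_iff.1 e).1 ▸ e)

/-- Weakening of a crisp term by cohesive variables. -/
theorem wkn (h : Derivable R (ctx Δ [])) (ha : Derivable R (ty Δ [] a A))
    (h' : Derivable R (ctx Δ Γ')) : Derivable R (ty Δ Γ' a A) := weaken h ha h'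

theorem wkn_eq (h : Derivable R (ctx Δ [])) (ha : Derivable R (eq Δ [] a b A))
    (h' : Derivable R (ctx Δ Γ')) : Derivable R (eq Δ Γ' a b A) := weaken_eq h ha h'

/-- Weakening of a crisp term by a crisp variable. -/
theorem cwk (h : Derivable R (ctx (X :: Δ) [])) (ha : Derivable R (ty Δ [] a A)) :
    Derivable R (ty (X :: Δ) [] a.cwk A.cwk) := by
  simp only [Tm.cwk, Tm.cwkn, ← Tm.subst_ofRen]
  refine subst_ty _ h (fun i B e => ?_) forall_getElem?_nil ha
  rw [Tm.subst_ofRen, Tm.cwkn, Tm.ren_ren]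
  exact ty_cvar h (i := i + 1) e

/-- Instantiation of a cohesive variable. -/
theorem inst {t T : Tm S} (h : ClosedCtx R Δ) (h' : Derivable R (ctx Δ Γ))
    (ht : Derivable R (ty Δ [X] t T)) (ha : Derivable R (ty Δ Γ a X)) :
    Derivable R (ty Δ Γ (t.inst a) (T.inst a)) := by
  refine subst_ty _ h' (fun i B e => ?_) (forall_getElem?_cons ?_ forall_getElem?_nil) ht
  -- The substitution also acts on the types of the crisp variables; it fixes them because no
  -- cohesive variable occurs there. This is the purpose of `ClosedCtx.closed`.
  · rw [((h.closed B (List.mem_of_getElem? e)).cwkn _).subst_eq]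
    exact ty_cvar h.ctx e
  · change Derivable R (ty Δ Γ a (X.wk.inst a))
    rwa [Tm.wk_inst]

theorem cvar_zero (h : Derivable R (ctx (X :: Δ) Γ)) :
    Derivable R (ty (X :: Δ) Γ (cvar 0) X.cwk) := ty_cvar h rfl

theorem var_zero (h : Derivable R (ctx Δ (X :: Γ))) :
    Derivable R (ty Δ (X :: Γ) (var 0) X.wk) := ty_var h rfl

/-- The bridge from judgmental computation to the identifications demanded by `isEquiv` and by
commuting squares. -/
theorem refl_of_eq (hA : Derivable R (ty Δ Γ A (univ l))) (ha : Derivable R (ty Δ Γ a A))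
    (h : Derivable R (eq Δ Γ a b A)) : Derivable R (ty Δ Γ (refl a) (id A a b)) :=
  ty_conv (id_intro ha) (id_form_eq (eq_refl hA) (eq_refl ha) h)

theorem app_ty {X Y f : Tm S} (hf : Derivable R (ty Δ Γ f (arrow X Y)))
    (ha : Derivable R (ty Δ Γ a X)) : Derivable R (ty Δ Γ (app f a) Y) := by
  have := pi_elim hf ha
  rwa [Tm.wk_inst] at this

theorem app_eq {X Y f f' : Tm S} (hf : Derivable R (eq Δ Γ f f' (arrow X Y)))
    (ha : Derivable R (eq Δ Γ a b X)) : Derivable R (eq Δ Γ (app f a) (app f' b) Y) := by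
  have := pi_elim_eq hf ha
  rwa [Tm.wk_inst] at this

end Derivable

namespace CohClosed

variable {A : Tm S}

theorem flat (h : CohClosed A) : CohClosed (flat A) := fun c τ τ' => congrArg Tm.flat (h c τ τ')

theorem sharp (h : CohClosed A) : CohClosed (sharp A) :=
  fun c τ τ' => congrArg Tm.sharp (h c τ τ')

end CohClosed

/-! ### Equivalences between types without cohesive variables. -/

theorem Tm.isEquiv_of_closed {X Y f : Tm S} (hX : CohClosed X) (hY : CohClosed Y)
    (hf : CohClosed f) : isEquiv X Y f =
      sigma (sigma (pi Y X) (pi Y (id Y (app f (app (var 1) (var 0))) (var 0))))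
        (sigma (pi Y X) (pi X (id X (app (var 1) (app f (var 0))) (var 0)))) := by
  rw [isEquiv, arrow, hX.wk, hY.wk, Tm.wkn_two, Tm.wkn_two, Tm.wkn_two, hX.wk, hX.wk, hY.wk, hY.wk,
    hf.wk, hf.wk]
  congr 1
  have e : ∀ {t : Tm S}, CohClosed t → ∀ τ, t.ren (fun i => i) τ = t := fun h τ =>
    (Tm.subst_ofRen _ (fun i => i) τ).symm.trans (h.subst_eq _)
  simp only [Tm.wk, Tm.wkn, Tm.ren, e hX, e hY, e hf, liftRen]

namespace Derivable

variable {Δ : Zone S} {X Y f g H K : Tm S} {l : ℕ}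

theorem arrow_form (h : ClosedCtx R Δ) (hX : Derivable R (ty Δ [] X (univ l)))
    (hY : Derivable R (ty Δ [] Y (univ l))) (hY' : CohClosed Y) :
    Derivable R (ty Δ [] (arrow X Y) (univ l)) := by
  rw [arrow, hY'.wk]
  exact pi_form hX (wkn h.ctx hY (ctx_coh h.ctx hX))

/-- A closed function with a left and a right inverse is an equivalence. -/
theorem isEquiv_intro (h : ClosedCtx R Δ) (hX : Derivable R (ty Δ [] X (univ l)))
    (hX' : CohClosed X) (hY : Derivable R (ty Δ [] Y (univ l))) (hY' : CohClosed Y)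
    (hf : Derivable R (ty Δ [] f (arrow X Y))) (hf' : CohClosed f)
    (hg : Derivable R (ty Δ [] g (arrow Y X))) (hg' : CohClosed g)
    (hH : Derivable R (ty Δ [] H (pi Y (id Y (app f (app g (var 0))) (var 0)))))
    (hK : Derivable R (ty Δ [] K (pi X (id X (app g (app f (var 0))) (var 0))))) :
    Derivable R (ty Δ [] (pair (pair g H) (pair g K)) (isEquiv X Y f)) := by
  rw [Tm.isEquiv_of_closed hX' hY' hf']
  have hYX := arrow_form h hY hX hX'
  have c1 := ctx_coh h.ctx hYX
  rw [arrow, hX'.wk] at hYX c1 hg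
  rw [arrow, hY'.wk] at hf
  have c2 := ctx_coh c1 (wkn h.ctx hY c1)
  have c3 := ctx_coh c1 (wkn h.ctx hX c1)
  have vY : Derivable R (ty Δ [Y, pi Y X] (var 0) Y) := by
    have := var_zero c2; rwa [hY'.wk] at this
  have vX : Derivable R (ty Δ [X, pi Y X] (var 0) X) := by
    have := var_zero c3; rwa [hX'.wk] at this
  have e : (pi Y X).wkn 2 = pi Y X := by
    have : CohClosed (pi Y X) := fun c τ τ' => congrArg₂ pi (hY' c τ τ') (hX' _ _ _)
    rw [Tm.wkn_two, this.wk, this.wk]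
  have v1 : Derivable R (ty Δ [Y, pi Y X] (var 1) (pi Y X)) := by
    have := ty_var c2 (j := 1) rfl; rwa [e] at this
  have v1' : Derivable R (ty Δ [X, pi Y X] (var 1) (pi Y X)) := by
    have := ty_var c3 (j := 1) rfl; rwa [e] at this
  have a1 := pi_elim v1 vY
  have a2 := pi_elim (wkn h.ctx hf c3) vX
  rw [hX'.inst] at a1
  rw [hY'.inst] at a2
  have b1 := pi_elim (wkn h.ctx hf c2) a1
  have b2 := pi_elim v1' a2
  rw [hY'.inst] at b1
  rw [hX'.inst] at b2
  have T1 := pi_form (wkn h.ctx hY c1) (id_form (wkn h.ctx hY c2) b1 vY)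
  have T2 := pi_form (wkn h.ctx hX c1) (id_form (wkn h.ctx hX c3) b2 vX)
  have P2 : Derivable R (ty Δ [] (pair g K) _) := sigma_intro T2 hg (by
    simp only [Tm.inst, Tm.subst, hX'.subst_eq, hX'.subst_up, hf'.subst_up]
    convert hK using 3
    simp only [Sub.up, hg'.wk])
  refine sigma_intro (wkn h.ctx (sigma_form hYX T2) (ctx_coh h.ctx (sigma_form hYX T1)))
    (sigma_intro T1 hg ?_) ?_
  · simp only [Tm.inst, Tm.subst, hY'.subst_eq, hY'.subst_up, hf'.subst_up]
    convert hH using 3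
    simp only [Sub.up, hg'.wk]
  -- The type of left inverses does not depend on the chosen right inverse, so instantiating it at
  -- `pair g H` changes nothing.
  · rw [CohClosed.inst]
    · exact P2
    · intro c τ τ'
      simp only [Tm.subst]
      congr 1
      · exact congrArg₂ pi (hY' c τ τ') (hX' _ _ _)
      · congr 1
        · exact hX' _ _ _
        · congr 1
          · exact hX' _ _ _
          · exact congrArg₂ Tm.app rfl (congrArg₂ Tm.app (hf' _ _ _) rfl)

end Derivable

/-! ### Functions `♭ X → ♭ Y` determined by a term in a crisp variable. -/

namespace Tm

/-- The function `♭ X → ♭ Y`, `z ↦ let u^♭ := z in t^♭`, for crisp `X`, `Y` and a crisp term `t`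
of type `Y` in a crisp variable `u :: X`. -/
def letFlat (X Y t : Tm S) : Tm S := lam (flat X) (flatE (flat Y) (var 0) (flatI t))

theorem arrow_cwk (X Y : Tm S) : (arrow X Y).cwk = arrow X.cwk Y.cwk := by
  simp only [arrow, cwk, cwkn, ren, wk, wkn, ren_ren, liftRen]

/-- Weakening by one crisp variable below the last one. -/
def cwkUnder (t : Tm S) : Tm S := t.ren (liftRen (· + 1)) (fun j => j)

theorem letFlat_cwk (X Y t : Tm S) : (letFlat X Y t).cwk = letFlat X.cwk Y.cwk t.cwkUnder := by
  simp only [letFlat, cwk, cwkn, ren, liftRen_id, cwkUnder]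

theorem cwk_cwkUnder (t : Tm S) : t.cwk.cwkUnder = t.cwk.cwk := by
  simp only [cwk, cwkn, cwkUnder, ren_ren, liftRen]

/-- The weakening inserts a crisp variable just below the last one; substituting that inserted
variable for the last one undoes it. -/
theorem cwkUnder_cinst_cvar_zero (t : Tm S) : t.cwkUnder.cinst (cvar 0) = t := by
  rw [cwkUnder, cinst, ren_subst]
  refine Eq.trans ?_ t.subst_id
  congr 1
  exact Sub.ext' (fun i => by cases i <;> rfl) (fun _ => rfl)

end Tm

theorem CohClosed.cwkUnder {t : Tm S} (h : CohClosed t) : CohClosed t.cwkUnder := fun c τ τ' => by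
  rw [Tm.cwkUnder, Tm.ren_subst, Tm.ren_subst]; exact h _ _ _

theorem CohClosed.letFlat {X Y t : Tm S} (hX : CohClosed X) (hY : CohClosed Y)
    (ht : CohClosed t) : CohClosed (letFlat X Y t) := fun c τ τ' => by
  simp only [Tm.letFlat, Tm.subst]
  congr 1
  · exact congrArg _ (hX c τ τ')
  · congr 1
    · exact congrArg _ (hY _ _ _)
    · exact congrArg _ (ht _ _ _)

namespace Derivable

variable {Δ : Zone S} {X Y Z t r a C N T : Tm S} {l l' : ℕ}

theorem cwkUnder (h : Derivable R (ctx (X.cwk :: Z :: Δ) []))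
    (ht : Derivable R (ty (X :: Δ) [] t T)) :
    Derivable R (ty (X.cwk :: Z :: Δ) [] t.cwkUnder T.cwkUnder) := by
  simp only [Tm.cwkUnder, ← Tm.subst_ofRen]
  refine subst_ty _ h (forall_getElem?_cons ?_ fun i B e => ?_) forall_getElem?_nil ht
  · have := cvar_zero h
    rw [Tm.subst_ofRen, Tm.cwkn, Tm.ren_ren]
    rwa [Tm.cwk, Tm.cwkn, Tm.cwk, Tm.cwkn, Tm.ren_ren] at this
  · rw [Tm.subst_ofRen, Tm.cwkn, Tm.ren_ren]
    exact ty_cvar h (i := i + 2) e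

/-- Induction over `♭ X` for a crisp type `X`. -/
theorem flat_ind (h : ClosedCtx R Δ) (hX : Derivable R (ty Δ [] X (univ l))) (hX' : CohClosed X)
    (hC : Derivable R (ty Δ [flat X] C (univ l'))) (hC' : C.inst (var 0) = C)
    (hN : Derivable R (ty (X :: Δ) [] N C.instFlatVar)) :
    Derivable R (ty Δ [flat X] (flatE C (var 0) N) C) := by
  have c1 := ctx_coh h.ctx (flat_form h.ctx hX)
  have c2 := ctx_coh c1 (flat_form c1 hX)
  have v := var_zero c1
  rw [hX'.flat.wk] at v
  have h' := h.cons hX hX'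
  have := flat_elim (Γ := [flat X]) (N := N) (weaken h.ctx hC c2) v (wkn h'.ctx hN
    (ctx_coh h'.ctx (flat_form h'.ctx (cwk h'.ctx hX))))
  rwa [hC'] at this

theorem letFlat_body (h : ClosedCtx R Δ) (hX : Derivable R (ty Δ [] X (univ l)))
    (hX' : CohClosed X) (hY : Derivable R (ty Δ [] Y (univ l))) (hY' : CohClosed Y)
    (ht : Derivable R (ty (X :: Δ) [] t Y.cwk)) :
    Derivable R (ty Δ [flat X] (flatE (flat Y) (var 0) (flatI t)) (flat Y)) := by
  have c1 := ctx_coh h.ctx (flat_form h.ctx hX)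
  refine flat_ind h hX hX' (flat_form c1 hY) (hY'.flat.inst _) ?_
  rw [hY'.flat.instFlatVar]
  exact flat_intro (h.cons hX hX').ctx ht

theorem letFlat_ty (h : ClosedCtx R Δ) (hX : Derivable R (ty Δ [] X (univ l)))
    (hX' : CohClosed X) (hY : Derivable R (ty Δ [] Y (univ l))) (hY' : CohClosed Y)
    (ht : Derivable R (ty (X :: Δ) [] t Y.cwk)) :
    Derivable R (ty Δ [] (letFlat X Y t) (arrow (flat X) (flat Y))) := by
  rw [arrow, hY'.flat.wk]
  exact pi_intro (letFlat_body h hX hX' hY hY' ht)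

theorem letFlat_beta (h : ClosedCtx R Δ) (hX : Derivable R (ty Δ [] X (univ l)))
    (hX' : CohClosed X) (hY : Derivable R (ty Δ [] Y (univ l))) (hY' : CohClosed Y)
    (ht : Derivable R (ty (X :: Δ) [] t Y.cwk)) (ht' : CohClosed t)
    (ha : Derivable R (ty Δ [] a X)) :
    Derivable R (eq Δ [] (app (letFlat X Y t) (flatI a)) (flatI (t.cinst a)) (flat Y)) := by
  have c1 := ctx_coh h.ctx (flat_form h.ctx hX)
  have e1 := pi_beta (letFlat_body h hX hX' hY hY' ht) (flat_intro h.ctx ha)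
  have e2 := flat_beta (Γ := []) (C := flat Y) (N := flatI t) (flat_form c1 hY) ha (by
    rw [hY'.flat.instFlatVar]
    exact flat_intro (h.cons hX hX').ctx ht)
  rw [hY'.flat.inst] at e1 e2
  have e3 : (flatE (flat Y) (var 0) (flatI t)).inst (flatI a) =
      flatE (flat Y) (flatI a) (flatI t) := by
    simp only [Tm.inst, Tm.subst, hY'.subst_up, ht'.subst_cup]
  rw [e3] at e1
  exact eq_trans e1 e2

/-- The computation rule of `letFlat` in a context extended by the crisp variable that it is
applied to. -/
theorem letFlat_cwk_beta (h : ClosedCtx R Δ) (hZ : Derivable R (ty Δ [] Z (univ l)))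
    (hZ' : CohClosed Z) (hX : Derivable R (ty Δ [] X (univ l)))
    (hX' : CohClosed X) (hY : Derivable R (ty Δ [] Y (univ l))) (hY' : CohClosed Y)
    (ht : Derivable R (ty (X :: Δ) [] t Y.cwk)) (ht' : CohClosed t)
    (ha : Derivable R (ty (Z :: Δ) [] a X.cwk)) :
    Derivable R (eq (Z :: Δ) [] (app (letFlat X Y t).cwk (flatI a)) (flatI (t.cwkUnder.cinst a))
      (flat Y.cwk)) := by
  have h1 := h.cons hZ hZ'
  have hX1 := cwk h1.ctx hX
  have hY1 := cwk h1.ctx hY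
  rw [Tm.letFlat_cwk]
  refine letFlat_beta h1 hX1 (hX'.cwkn 1) hY1 (hY'.cwkn 1) ?_ ht'.cwkUnder ha
  rw [← Tm.cwk_cwkUnder]
  exact cwkUnder (h1.cons hX1 (hX'.cwkn 1)).ctx ht

/-- The composite of two functions given by `letFlat`, on `u^♭` for a crisp variable `u`. -/
theorem letFlat_comp (h : ClosedCtx R Δ) (hX : Derivable R (ty Δ [] X (univ l)))
    (hX' : CohClosed X) (hY : Derivable R (ty Δ [] Y (univ l))) (hY' : CohClosed Y)
    (hZ : Derivable R (ty Δ [] Z (univ l))) (hZ' : CohClosed Z)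
    (ht : Derivable R (ty (X :: Δ) [] t Y.cwk)) (ht' : CohClosed t)
    (hr : Derivable R (ty (Y :: Δ) [] r Z.cwk)) (hr' : CohClosed r) :
    Derivable R (eq (X :: Δ) []
      (app (letFlat Y Z r).cwk (app (letFlat X Y t).cwk (flatI (cvar 0))))
      (flatI (r.cwkUnder.cinst t)) (flat Z.cwk)) := by
  have h1 := h.cons hX hX'
  have e1 := letFlat_cwk_beta h hX hX' hX hX' hY hY' ht ht' (cvar_zero h1.ctx)
  rw [Tm.cwkUnder_cinst_cvar_zero] at e1
  have e2 := letFlat_cwk_beta h hX hX' hY hY' hZ hZ' hr hr' ht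
  have hg := cwk h1.ctx (letFlat_ty h hY hY' hZ hZ' hr)
  rw [Tm.arrow_cwk] at hg
  exact eq_trans (app_eq (eq_refl hg) e1) e2

/-- A homotopy over `♭ X` is reduced to an identification at `u^♭` for crisp `u`. The equations
`ha'` and `hb'` say that only the last cohesive variable occurs in `a` and `b`. -/
theorem flat_homotopy {b p : Tm S} (h : ClosedCtx R Δ) (hX : Derivable R (ty Δ [] X (univ l)))
    (hX' : CohClosed X) (hT : Derivable R (ty Δ [] T (univ l'))) (hT' : CohClosed T)
    (ha : Derivable R (ty Δ [flat X] a T)) (hb : Derivable R (ty Δ [flat X] b T))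
    (ha' : a.inst (var 0) = a) (hb' : b.inst (var 0) = b)
    (hp : Derivable R (ty (X :: Δ) [] p (id T.cwk a.instFlatVar b.instFlatVar))) :
    Derivable R (ty Δ [] (lam (flat X) (flatE (id T a b) (var 0) p)) (pi (flat X) (id T a b))) := by
  refine pi_intro (flat_ind h hX hX' (id_form (wkn h.ctx hT (ctx_coh h.ctx
    (flat_form h.ctx hX))) ha hb) ?_ ?_)
  · change id (T.inst _) (a.inst _) (b.inst _) = _
    rw [hT'.inst, ha', hb']
  · rw [← hT'.instFlatVar] at hp
    exact hp

theorem letFlat_comp_ty {φ ψ : Tm S} (h : ClosedCtx R Δ)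
    (hX : Derivable R (ty Δ [] X (univ l))) (hX' : CohClosed X)
    (hφ : Derivable R (ty Δ [] φ (arrow (flat X) Y))) (hψ : Derivable R (ty Δ [] ψ (arrow Y Z))) :
    Derivable R (ty Δ [flat X] (app ψ (app φ (var 0))) Z) := by
  have c1 := ctx_coh h.ctx (flat_form h.ctx hX)
  have v := var_zero c1
  rw [hX'.flat.wk] at v
  exact app_ty (wkn h.ctx hψ c1) (app_ty (wkn h.ctx hφ c1) v)

/-- Functions given by crisp terms that are inverse to each other are inverse equivalences. -/
theorem letFlat_isEquiv {p q : Tm S} (h : ClosedCtx R Δ) (hX : Derivable R (ty Δ [] X (univ l)))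
    (hX' : CohClosed X) (hY : Derivable R (ty Δ [] Y (univ l))) (hY' : CohClosed Y)
    (ht : Derivable R (ty (X :: Δ) [] t Y.cwk)) (ht' : CohClosed t)
    (hr : Derivable R (ty (Y :: Δ) [] r X.cwk)) (hr' : CohClosed r)
    (hp : Derivable R
      (ty (X :: Δ) [] p (id (flat X.cwk) (flatI (r.cwkUnder.cinst t)) (flatI (cvar 0)))))
    (hq : Derivable R
      (ty (Y :: Δ) [] q (id (flat Y.cwk) (flatI (t.cwkUnder.cinst r)) (flatI (cvar 0))))) :
    ∃ w, Derivable R (ty Δ [] w (isEquiv (flat X) (flat Y) (letFlat X Y t))) := by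
  -- Kept general in both types so that exchanging their roles yields the second homotopy.
  have key : ∀ {X Y t r p : Tm S}, Derivable R (ty Δ [] X (univ l)) → CohClosed X →
      Derivable R (ty Δ [] Y (univ l)) → CohClosed Y →
      Derivable R (ty (X :: Δ) [] t Y.cwk) → CohClosed t →
      Derivable R (ty (Y :: Δ) [] r X.cwk) → CohClosed r →
      Derivable R
        (ty (X :: Δ) [] p (id (flat X.cwk) (flatI (r.cwkUnder.cinst t)) (flatI (cvar 0)))) →
      ∃ w, Derivable R (ty Δ [] w (pi (flat X)
        (id (flat X) (app (letFlat Y X r) (app (letFlat X Y t) (var 0))) (var 0)))) := by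
    intro X Y t r p hX hX' hY hY' ht ht' hr hr' hp
    have hφ := letFlat_ty h hX hX' hY hY' ht
    have hψ := letFlat_ty h hY hY' hX hX' hr
    have cφ := hX'.letFlat hY' ht'
    have cψ := hY'.letFlat hX' hr'
    have c1 := ctx_coh h.ctx (flat_form h.ctx hX)
    have v := var_zero c1
    rw [hX'.flat.wk] at v
    refine ⟨_, flat_homotopy (p := p) h hX hX' (flat_form h.ctx hX) hX'.flat
      (letFlat_comp_ty h hX hX' hφ hψ) v ?_ rfl ?_⟩
    · exact congrArg₂ app (cψ.inst _) (congrArg₂ app (cφ.inst _) rfl)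
    · have h1 := h.cons hX hX'
      have v1 := flat_intro h1.ctx (cvar_zero h1.ctx)
      have e := letFlat_comp h hX hX' hY hY' hX hX' ht ht' hr hr'
      -- At `u^♭` the composite computes to `(r(t(u)))^♭`, so `p` has the required type after
      -- conversion.
      have e' := ty_conv hp (id_form_eq (eq_refl (flat_form h1.ctx (cwk h1.ctx hX))) (eq_symm e)
        (eq_refl v1))
      have e2 : (app (letFlat Y X r) (app (letFlat X Y t) (var 0))).instFlatVar =
        app (letFlat Y X r).cwk (app (letFlat X Y t).cwk (flatI (cvar 0))) :=
        congrArg₂ app cψ.instFlatVar (congrArg₂ app cφ.instFlatVar rfl)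
      rw [e2]
      exact e'
  obtain ⟨K, hK⟩ := key hX hX' hY hY' ht ht' hr hr' hp
  obtain ⟨H, hH⟩ := key hY hY' hX hX' hr hr' ht ht' hq
  exact ⟨_, isEquiv_intro h (flat_form h.ctx hX) hX'.flat (flat_form h.ctx hY) hY'.flat
    (letFlat_ty h hX hX' hY hY' ht) (hX'.letFlat hY' ht')
    (letFlat_ty h hY hY' hX hX' hr) (hY'.letFlat hX' hr') hH hK⟩

/-- A square of functions given by crisp terms commutes if it does so judgmentally. -/
theorem letFlat_square {X' Y' t' a b : Tm S} (h : ClosedCtx R Δ)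
    (hX : Derivable R (ty Δ [] X (univ l))) (cX : CohClosed X)
    (hY : Derivable R (ty Δ [] Y (univ l))) (cY : CohClosed Y)
    (hX' : Derivable R (ty Δ [] X' (univ l))) (cX' : CohClosed X')
    (hY' : Derivable R (ty Δ [] Y' (univ l))) (cY' : CohClosed Y')
    (ht : Derivable R (ty (X :: Δ) [] t Y.cwk)) (ct : CohClosed t)
    (ht' : Derivable R (ty (X' :: Δ) [] t' Y'.cwk)) (ct' : CohClosed t')
    (ha : Derivable R (ty (X :: Δ) [] a X'.cwk)) (ca : CohClosed a)
    (hb : Derivable R (ty (Y :: Δ) [] b Y'.cwk)) (cb : CohClosed b)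
    (e : Derivable R (eq (X :: Δ) [] (t'.cwkUnder.cinst a) (b.cwkUnder.cinst t) Y'.cwk)) :
    CommutesCrisply R Δ (flat X) (flat Y') (letFlat X Y t) (letFlat X' Y' t') (letFlat X X' a)
      (letFlat Y Y' b) := by
  have h1 := h.cons hX cX
  have cφ := cX.letFlat cY ct
  have cφ' := cX'.letFlat cY' ct'
  have cp := cX.letFlat cX' ca
  have cq := cY.letFlat cY' cb
  have e1 := letFlat_comp h hX cX hX' cX' hY' cY' ha ca ht' ct'
  have e2 := letFlat_comp h hX cX hY cY hY' cY' ht ct hb cb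
  have e3 := eq_trans (eq_trans e1 (flat_intro_eq h1.ctx e)) (eq_symm e2)
  have t1 := letFlat_comp_ty h hX cX (letFlat_ty h hX cX hX' cX' ha)
    (letFlat_ty h hX' cX' hY' cY' ht')
  have t2 := letFlat_comp_ty h hX cX (letFlat_ty h hX cX hY cY ht) (letFlat_ty h hY cY hY' cY' hb)
  have v1 := flat_intro h1.ctx (cvar_zero h1.ctx)
  have hp := cwk h1.ctx (letFlat_ty h hX cX hX' cX' ha)
  have hφ' := cwk h1.ctx (letFlat_ty h hX' cX' hY' cY' ht')
  rw [Tm.arrow_cwk] at hp hφ'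
  have r := refl_of_eq (flat_form h1.ctx (cwk h1.ctx hY')) (app_ty hφ' (app_ty hp v1)) e3
  rw [CommutesCrisply, cY'.flat.wk, cφ'.wk, cp.wk, cq.wk, cφ.wk]
  refine ⟨_, flat_homotopy
    (p := refl (app (letFlat X' Y' t').cwk (app (letFlat X X' a).cwk (flatI (cvar 0)))))
    h hX cX (flat_form h.ctx hY') cY'.flat t1 t2
    (congrArg₂ app (cφ'.inst _) (congrArg₂ app (cp.inst _) rfl))
    (congrArg₂ app (cq.inst _) (congrArg₂ app (cφ.inst _) rfl)) ?_⟩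
  · rw [show (app (letFlat X' Y' t') (app (letFlat X X' a) (var 0))).instFlatVar =
        app (letFlat X' Y' t').cwk (app (letFlat X X' a).cwk (flatI (cvar 0))) from
        congrArg₂ app cφ'.instFlatVar (congrArg₂ app cp.instFlatVar rfl),
      show (app (letFlat Y Y' b) (app (letFlat X Y t) (var 0))).instFlatVar =
        app (letFlat Y Y' b).cwk (app (letFlat X Y t).cwk (flatI (cvar 0))) from
        congrArg₂ app cq.instFlatVar (congrArg₂ app cφ.instFlatVar rfl)]
    exact r

end Derivable

/-! ### Instantiation of generic derivations -/

namespace Tm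

/-- The constructions in the statement commute with substitution, so that equivalences and squares
over a context of variables specialise to those for given types and maps. -/
theorem arrow_subst (X Y : Tm S) (s : Sub S) :
    (arrow X Y).subst s = arrow (X.subst s) (Y.subst s) := by
  simp only [arrow, subst, wk_subst_up]

theorem isEquiv_subst (X Y f : Tm S) (s : Sub S) :
    (isEquiv X Y f).subst s = isEquiv (X.subst s) (Y.subst s) (f.subst s) := by
  simp only [isEquiv, arrow, wkn_two, subst, wk_subst_up]
  rfl

theorem flatMap_subst (X Y f : Tm S) (s : Sub S) :
    (flatMap X Y f).subst s = flatMap (X.subst s) (Y.subst s) (f.subst s) := by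
  simp only [flatMap, wkn_two, subst, wk_subst_up, cwk_subst_cup]
  rfl

theorem sharpMap_subst (X f : Tm S) (s : Sub S) :
    (sharpMap X f).subst s = sharpMap (X.subst s) (f.subst s) := by
  simp only [sharpMap, subst, wk_subst_up]
  rfl

theorem homMap_subst (A B A' f g : Tm S) (s : Sub S) : (homMap A B A' f g).subst s =
    homMap (A.subst s) (B.subst s) (A'.subst s) (f.subst s) (g.subst s) := by
  simp only [homMap, wkn_two, subst, wk_subst_up, arrow_subst]
  rfl

theorem counit_subst (A a : Tm S) (s : Sub S) :
    (counit A a).subst s = counit (A.subst s) (a.subst s) := by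
  simp only [counit, subst, wk_subst_up]
  rfl

theorem piCounit_subst (A B : Tm S) (s : Sub S) :
    (piCounit A B).subst s = piCounit (A.subst s) (B.subst s) := by
  simp only [piCounit, subst, wk_subst_up, counit_subst]
  rfl

theorem piSharp_subst (A B : Tm S) (s : Sub S) :
    (piSharp A B).subst s = piSharp (A.subst s) (B.subst s) := by
  simp only [piSharp, subst, wk_subst_up]
  rfl

theorem piCounitMap_subst (A B A' B' f g : Tm S) (s : Sub S) :
    (piCounitMap A B A' B' f g).subst s = piCounitMap (A.subst s) (B.subst s) (A'.subst s)
      (B'.subst s) (f.subst s) (g.subst s) := by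
  simp only [piCounitMap, wkn_two, wkn_three, subst, wk_subst_up, cwk_subst_cup, piCounit_subst,
    counit_subst]
  rfl

theorem piSharpMap_subst (A B A' f g : Tm S) (s : Sub S) :
    (piSharpMap A B A' f g).subst s = piSharpMap (A.subst s) (B.subst s) (A'.subst s)
      (f.subst s) (g.subst s) := by
  simp only [piSharpMap, wkn_two, subst, wk_subst_up, piSharp_subst]
  rfl

theorem crispify_zero (t : Tm S) : t.crispify 0 = t := t.subst_id

end Tm

/-- `s` maps the variables of the crisp context `Δ₀` to terms over the crisp context `Δ`. -/
def TypedSub (R : Set (List (Judgment S) × Judgment S)) (Δ₀ Δ : Zone S) (s : Sub S) : Prop :=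
  ∀ i B, Δ₀[i]? = some B → Derivable R (ty Δ [] (s.crisp i) ((B.cwkn (i + 1)).subst s))

section

variable {Δ₀ Δ : Zone S} {s : Sub S} {X Y Y' φ φ' p q a A : Tm S}

/-- The cohesive half of `s` carries no condition because the source context has no cohesive
variables. -/
theorem TypedSub.crisp (hs : TypedSub R Δ₀ Δ s) (h : IsCrispCtx R Δ)
    (ha : Derivable R (ty Δ₀ [] a A)) : Derivable R (ty Δ [] (a.subst s) (A.subst s)) :=
  .subst_ty s h hs forall_getElem?_nil ha

theorem TypedSub.isCrispEquivalence (hs : TypedSub R Δ₀ Δ s) (h : IsCrispCtx R Δ)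
    (H : IsCrispEquivalence R Δ₀ X Y φ) :
    IsCrispEquivalence R Δ (X.subst s) (Y.subst s) (φ.subst s) := by
  obtain ⟨H, w, hw⟩ := H
  refine ⟨?_, w.subst s, ?_⟩
  · rw [← Tm.arrow_subst]; exact hs.crisp h H
  · rw [← Tm.isEquiv_subst]; exact hs.crisp h hw

theorem TypedSub.commutesCrisply (hs : TypedSub R Δ₀ Δ s) (h : IsCrispCtx R Δ)
    (H : CommutesCrisply R Δ₀ X Y' φ φ' p q) :
    CommutesCrisply R Δ (X.subst s) (Y'.subst s) (φ.subst s) (φ'.subst s) (p.subst s)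
      (q.subst s) := by
  obtain ⟨w, hw⟩ := H
  refine ⟨w.subst s, ?_⟩
  have := hs.crisp h hw
  simp only [Tm.subst, Tm.wk_subst_up] at this
  exact this

end

/-! ### The rules of `♯` over at most one cohesive variable, and the functorial action of `♯`. -/

namespace Derivable

variable {Δ : Zone S} {A M M' : Tm S} {l : ℕ}

theorem sharp_form_crisp (hA : Derivable R (ty Δ [] A (univ l))) :
    Derivable R (ty Δ [] (sharp A) (univ l)) :=
  sharp_form ((crispify_zero A).symm ▸ hA)

theorem sharp_intro_crisp (hM : Derivable R (ty Δ [] M A)) :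
    Derivable R (ty Δ [] (sharpI M) (sharp A)) :=
  sharp_intro (by
    rw [List.length_nil, crispify_zero, crispify_zero]; exact hM)

theorem sharp_intro_eq_crisp (hM : Derivable R (eq Δ [] M M' A)) :
    Derivable R (eq Δ [] (sharpI M) (sharpI M') (sharp A)) :=
  sharp_intro_eq (by
    rw [List.length_nil, crispify_zero, crispify_zero, crispify_zero]; exact hM)

/-- With a single cohesive variable the joined context is `F.crispify 0 :: Δ`, and `crispify 0` is
the identity. -/
theorem sharp_form_single {F : Tm S}
    (hA : Derivable R (ty (F :: Δ) [] (A.crispify 1) (univ l))) :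
    Derivable R (ty Δ [F] (sharp A) (univ l)) := by
  refine sharp_form ?_
  rw [Zone.join, List.length_nil, crispify_zero]
  exact hA

theorem sharp_intro_single {F : Tm S}
    (hM : Derivable R (ty (F :: Δ) [] (M.crispify 1) (A.crispify 1))) :
    Derivable R (ty Δ [F] (sharpI M) (sharp A)) := by
  refine sharp_intro ?_
  rw [Zone.join, List.length_nil, crispify_zero]
  exact hM

theorem sharp_intro_eq_single {F : Tm S}
    (hM : Derivable R (eq (F :: Δ) [] (M.crispify 1) (M'.crispify 1) (A.crispify 1))) :
    Derivable R (eq Δ [F] (sharpI M) (sharpI M') (sharp A)) := by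
  refine sharp_intro_eq ?_
  rw [Zone.join, List.length_nil, crispify_zero]
  exact hM

theorem sharpMap_body {X Y f : Tm S} (h : ClosedCtx R Δ) (hX : Derivable R (ty Δ [] X (univ l)))
    (hX' : CohClosed X) (hY' : CohClosed Y) (hf : Derivable R (ty Δ [] f (arrow X Y)))
    (hf' : CohClosed f) :
    Derivable R (ty Δ [sharp X] (sharpI (app f.wk (sharpE (var 0)))) (sharp Y)) := by
  have h1 := h.cons (sharp_form_crisp hX) hX'.sharp
  refine sharp_intro_single ?_
  have hf1 := cwk h1.ctx hf
  rw [arrow_cwk] at hf1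
  rw [hf'.wk, hY'.crispify]
  change Derivable R (ty _ [] (app (f.crispify 1) (sharpE (cvar 0))) Y.cwk)
  rw [hf'.crispify]
  exact app_ty hf1 (sharp_elim h1.ctx (cvar_zero h1.ctx))

theorem sharpMap_ty {X Y f : Tm S} (h : ClosedCtx R Δ) (hX : Derivable R (ty Δ [] X (univ l)))
    (hX' : CohClosed X) (hY' : CohClosed Y) (hf : Derivable R (ty Δ [] f (arrow X Y)))
    (hf' : CohClosed f) : Derivable R (ty Δ [] (sharpMap X f) (arrow (sharp X) (sharp Y))) := by
  rw [arrow, hY'.sharp.wk]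
  exact pi_intro (sharpMap_body h hX hX' hY' hf hf')

theorem sharpMap_beta {Γ : Zone S} {X Y f N : Tm S} (h : ClosedCtx R Δ)
    (hΓ : Derivable R (ctx Δ Γ)) (hX : Derivable R (ty Δ [] X (univ l))) (hX' : CohClosed X)
    (hY' : CohClosed Y) (hf : Derivable R (ty Δ [] f (arrow X Y))) (hf' : CohClosed f)
    (hN : Derivable R (ty Δ Γ N (sharp X))) :
    Derivable R (eq Δ Γ (app (sharpMap X f) N) (sharpI (app f (sharpE N))) (sharp Y)) := by
  have := pi_beta (weaken (Γ' := Γ) h.ctx (sharpMap_body h hX hX' hY' hf hf')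
    (ctx_coh hΓ (wkn h.ctx (sharp_form_crisp hX) hΓ))) hN
  rw [hY'.sharp.inst] at this
  change Derivable R (eq Δ Γ _ (sharpI (app (f.wk.inst N) (sharpE N))) _) at this
  rwa [Tm.wk_inst] at this

end Derivable

open Derivable

/-! ### `♭ A ≃ ♭ ♯ A` -/

/-- The inverse is given by `v ↦ v_♯`. At crisp variables the two composites reduce to the identity
by the `β` and the `η` rule of `♯`. -/
theorem flat_sharp_isCrispEquivalence {Δ : Zone S} {A : Tm S} {l : ℕ} (h : ClosedCtx R Δ)
    (hA : Derivable R (ty Δ [] A (univ l))) (hA' : CohClosed A) :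
    IsCrispEquivalence R Δ (flat A) (flat (sharp A)) (letFlat A (sharp A) (sharpI (cvar 0))) := by
  have h1 := h.cons hA hA'
  have hs := sharp_form_crisp hA
  have h2 := h.cons hs hA'.sharp
  have ht := sharp_intro_crisp (cvar_zero h1.ctx)
  have hr := sharp_elim h2.ctx (cvar_zero h2.ctx)
  refine ⟨letFlat_ty h hA hA' hs hA'.sharp ht, ?_⟩
  refine letFlat_isEquiv h hA hA' hs hA'.sharp ht (fun _ _ _ => rfl) hr (fun _ _ _ => rfl)
    (refl_of_eq (flat_form h1.ctx (Derivable.cwk h1.ctx hA)) (flat_intro h1.ctx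
        (sharp_elim h1.ctx ht))
      (flat_intro_eq h1.ctx (sharp_beta h1.ctx (cvar_zero h1.ctx))))
    (refl_of_eq (flat_form h2.ctx (Derivable.cwk h2.ctx hs)) (flat_intro h2.ctx
        (sharp_intro_crisp hr)) (flat_intro_eq h2.ctx (sharp_eta (cvar_zero h2.ctx))))

theorem ClosedCtx.univ (l : ℕ) : ClosedCtx R [univ l] :=
  ClosedCtx.nil.cons (univ_ty .ctx_nil) fun _ _ _ => rfl

theorem ClosedCtx.univ_univ (l : ℕ) : ClosedCtx R [Tm.univ l, Tm.univ l] :=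
  (ClosedCtx.univ l).cons (univ_ty (ClosedCtx.univ l).ctx) fun _ _ _ => rfl

/-- Two types and a function between them. -/
theorem ClosedCtx.univ_univ_arrow (l : ℕ) :
    ClosedCtx R [arrow (cvar 1) (cvar 0), Tm.univ l, Tm.univ l] :=
  (ClosedCtx.univ_univ l).cons
    (arrow_form (ClosedCtx.univ_univ l) (ty_cvar (i := 1) (ClosedCtx.univ_univ l).ctx rfl)
      (cvar_zero (ClosedCtx.univ_univ l).ctx) fun _ _ _ => rfl) fun _ _ _ => rfl

/-- Both routes send `u^♭` to `((f u)^♯)^♭`; the route through `♯ f` needs the `β` rule of `♯`. -/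
theorem flat_sharp_square (l : ℕ) :
    CommutesCrisply R [arrow (cvar 1) (cvar 0), univ l, univ l] (flat (cvar 2))
      (flat (sharp (cvar 1))) (letFlat (cvar 2) (sharp (cvar 2)) (sharpI (cvar 0)))
      (letFlat (cvar 1) (sharp (cvar 1)) (sharpI (cvar 0))) (flatMap (cvar 2) (cvar 1) (cvar 0))
      (flatMap (sharp (cvar 2)) (sharp (cvar 1)) (sharpMap (cvar 2) (cvar 0))) := by
  have h : ClosedCtx R _ := ClosedCtx.univ_univ_arrow l
  have hA : Derivable R (ty _ [] (cvar 2) (univ l)) := ty_cvar (i := 2) h.ctx rfl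
  have hB : Derivable R (ty _ [] (cvar 1) (univ l)) := ty_cvar (i := 1) h.ctx rfl
  have hf : Derivable R (ty _ [] (cvar 0) (arrow (cvar 2) (cvar 1))) := ty_cvar (i := 0) h.ctx rfl
  have h1 := h.cons hA fun _ _ _ => rfl
  have hs := sharp_form_crisp hA
  have h2 := h.cons hs fun _ _ _ => rfl
  have hA1 : Derivable R (ty _ [] (cvar 3) (univ l)) := Derivable.cwk h1.ctx hA
  have hA2 : Derivable R (ty _ [] (cvar 3) (univ l)) := Derivable.cwk h2.ctx hA
  have hf1 : Derivable R (ty _ [] (cvar 1) (arrow (cvar 3) (cvar 2))) := Derivable.cwk h1.ctx hf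
  have hf2 : Derivable R (ty _ [] (cvar 1) (arrow (cvar 3) (cvar 2))) := Derivable.cwk h2.ctx hf
  have hu : Derivable R (ty _ [] (cvar 0) (cvar 3)) := cvar_zero h1.ctx
  have hv : Derivable R (ty _ [] (cvar 0) (sharp (cvar 3))) := cvar_zero h2.ctx
  have e := sharpMap_beta h1 h1.ctx hA1 (fun _ _ _ => rfl) (fun _ _ _ => rfl) hf1
    (fun _ _ _ => rfl) (sharp_intro_crisp hu)
  -- The terms `a` and `b` are the values of the two mapped functions at the new crisp variable, as
  -- they occur in the bodies of the `flatMap`s.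
  refine letFlat_square (a := app (cvar 1) (cvar 0)) (b := app (sharpMap (cvar 3) (cvar 1)) (cvar 0))
    h hA (fun _ _ _ => rfl) hs (fun _ _ _ => rfl) hB (fun _ _ _ => rfl) (sharp_form_crisp hB)
    (fun _ _ _ => rfl) (sharp_intro_crisp hu) (fun _ _ _ => rfl)
    (sharp_intro_crisp (cvar_zero (h.cons hB fun _ _ _ => rfl).ctx)) (fun _ _ _ => rfl)
    (app_ty hf1 hu) (fun _ _ _ => rfl)
    (app_ty (sharpMap_ty h2 hA2 (fun _ _ _ => rfl) (fun _ _ _ => rfl) hf2 (fun _ _ _ => rfl)) hv)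
    (fun _ _ _ => rfl) (eq_symm (eq_trans e (sharp_intro_eq_crisp
      (app_eq (eq_refl hf1) (sharp_beta h1.ctx hu)))))

/-- `♭ A ≃ ♭ ♯ A`, naturally in crisp `A`. -/
theorem exists_flat_sharp_equivalence (l : ℕ) : ∃ φ : Tm S,
    (∀ Δ A, IsCrispCtx R Δ → Crisp R Δ A (univ l) →
      IsCrispEquivalence R Δ (flat A) (flat (sharp A)) (φ.cinst A)) ∧
    (∀ Δ A A' f, IsCrispCtx R Δ → Crisp R Δ A (univ l) → Crisp R Δ A' (univ l) →
      Crisp R Δ f (arrow A A') →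
      CommutesCrisply R Δ (flat A) (flat (sharp A')) (φ.cinst A) (φ.cinst A')
        (flatMap A A' f) (flatMap (sharp A) (sharp A') (sharpMap A f))) := by
  refine ⟨letFlat (cvar 0) (sharp (cvar 0)) (sharpI (cvar 0)), ?_, ?_⟩
  · intro Δ A hΔ hA
    -- This substitution is the one that defines `cinst`, so the instantiated equivalence is the
    -- desired one by unfolding.
    have hs : TypedSub R [univ l] Δ ⟨fun | 0 => A | i + 1 => cvar i, var⟩ :=
      forall_getElem?_cons hA forall_getElem?_nil
    exact hs.isCrispEquivalence hΔ (flat_sharp_isCrispEquivalence (ClosedCtx.univ l)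
      (cvar_zero (ClosedCtx.univ l).ctx) fun _ _ _ => rfl)
  · intro Δ A A' f hΔ hA hA' hf
    have hs : TypedSub R [arrow (cvar 1) (cvar 0), univ l, univ l] Δ
        ⟨fun | 0 => f | 1 => A' | 2 => A | i + 3 => cvar i, var⟩ :=
      forall_getElem?_cons hf (forall_getElem?_cons hA' (forall_getElem?_cons hA
        forall_getElem?_nil))
    have := hs.commutesCrisply hΔ (flat_sharp_square l)
    rw [flatMap_subst, flatMap_subst, Tm.subst, sharpMap_subst] at this
    exact this

namespace Derivable

variable {Δ Γ : Zone S} {a a' M : Tm S} {l n : ℕ}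

/-! ### The counit of `♭` -/

/-- For a crisp variable `A` the motive `A.wk` of `counit` is that variable again, so no weakening
is written. -/
theorem counit_var_ty (h : ClosedCtx R Δ) (hA : Derivable R (ty Δ [] (cvar n) (univ l))) :
    Derivable R (ty Δ [flat (cvar n)] (flatE (cvar n) (var 0) (cvar 0)) (cvar n)) :=
  flat_ind h hA (fun _ _ _ => rfl) (wkn h.ctx hA (ctx_coh h.ctx (flat_form h.ctx hA))) rfl
    (cvar_zero (h.cons hA fun _ _ _ => rfl).ctx)

theorem counit_ty (h : ClosedCtx R Δ) (hΓ : Derivable R (ctx Δ Γ))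
    (hA : Derivable R (ty Δ [] (cvar n) (univ l))) (hM : Derivable R (ty Δ Γ M (flat (cvar n)))) :
    Derivable R (ty Δ Γ (flatE (cvar n) M (cvar 0)) (cvar n)) :=
  inst h hΓ (counit_var_ty h hA) hM

theorem counit_beta (h : ClosedCtx R Δ) (hA : Derivable R (ty Δ [] (cvar n) (univ l)))
    (ha : Derivable R (ty Δ [] a (cvar n))) :
    Derivable R (eq Δ [] (flatE (cvar n) (flatI a) (cvar 0)) a (cvar n)) :=
  flat_beta (Γ := []) (C := cvar n) (wkn h.ctx hA (ctx_coh h.ctx (flat_form h.ctx hA))) ha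
    (cvar_zero (h.cons hA fun _ _ _ => rfl).ctx)

theorem counit_eq (h : ClosedCtx R Δ) (hA : Derivable R (ty Δ [] (cvar n) (univ l)))
    (ha : Derivable R (eq Δ [] a a' (flat (cvar n)))) :
    Derivable R (eq Δ [] (flatE (cvar n) a (cvar 0)) (flatE (cvar n) a' (cvar 0)) (cvar n)) :=
  flat_elim_eq (Γ := []) (C := cvar n)
    (eq_refl (wkn h.ctx hA (ctx_coh h.ctx (flat_form h.ctx hA)))) ha
    (eq_refl (cvar_zero (h.cons hA fun _ _ _ => rfl).ctx))

end Derivable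

open Derivable

/-! ### Functions from a type to a codiscrete type agree on `♯` if they agree pointwise -/

/-- Types `X`, `Y`, functions `a, b : X → ♯ Y` and a homotopy between them. -/
def homotopyCtx (S : Signature) (l : ℕ) : Zone S :=
  [pi (cvar 3) (id (sharp (cvar 2)) (app (cvar 1) (var 0)) (app (cvar 0) (var 0))),
    arrow (cvar 2) (sharp (cvar 1)), arrow (cvar 1) (sharp (cvar 0)), univ l, univ l]

theorem ClosedCtx.homotopyCtx (l : ℕ) : ClosedCtx R (homotopyCtx S l) := by
  have h2 : ClosedCtx R _ := ClosedCtx.univ_univ l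
  have h3 := h2.cons (arrow_form h2 (ty_cvar (i := 1) h2.ctx rfl)
    (sharp_form_crisp (ty_cvar (i := 0) h2.ctx rfl)) fun _ _ _ => rfl) fun _ _ _ => rfl
  have h4 := h3.cons (arrow_form h3 (ty_cvar (i := 2) h3.ctx rfl)
    (sharp_form_crisp (ty_cvar (i := 1) h3.ctx rfl)) fun _ _ _ => rfl) fun _ _ _ => rfl
  have hX : Derivable R (ty _ [] (cvar 3) (Tm.univ l)) := ty_cvar (i := 3) h4.ctx rfl
  have hY : Derivable R (ty _ [] (cvar 2) (Tm.univ l)) := ty_cvar (i := 2) h4.ctx rfl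
  have c := ctx_coh h4.ctx hX
  have v : Derivable R (ty _ [cvar 3] (var 0) (cvar 3)) := var_zero c
  have ha : Derivable R (ty _ [] (cvar 1) (arrow (cvar 3) (sharp (cvar 2)))) :=
    ty_cvar (i := 1) h4.ctx rfl
  have hb : Derivable R (ty _ [] (cvar 0) (arrow (cvar 3) (sharp (cvar 2)))) :=
    ty_cvar (i := 0) h4.ctx rfl
  exact h4.cons (pi_form hX (id_form (wkn h4.ctx (sharp_form_crisp hY) c)
    (app_ty (wkn h4.ctx ha c) v) (app_ty (wkn h4.ctx hb c) v))) fun _ _ _ => rfl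

/-- Function extensionality turns the homotopy into a path `a = b`, and path induction reduces the
claim to reflexivity. The point is that the motive is well formed for cohesive functions `f`, `g`
and `z : ♯ X`: inside `(-)^♯` all of them count as crisp, so `(f (z_♯))_♯` makes sense there. -/
theorem homotopyCtx_sharp_ext (l : ℕ) : ∃ w : Tm S,
    Derivable R (ty (homotopyCtx S l) [sharp (cvar 4)] w (id (sharp (cvar 3))
      (sharpI (sharpE (app (cvar 2) (sharpE (var 0)))))
      (sharpI (sharpE (app (cvar 1) (sharpE (var 0))))))) := by
  have h : ClosedCtx R (homotopyCtx S l) := ClosedCtx.homotopyCtx l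
  have hX : Derivable R (ty _ [] (cvar 4) (univ l)) := ty_cvar (i := 4) h.ctx rfl
  have hY : Derivable R (ty _ [] (cvar 3) (univ l)) := ty_cvar (i := 3) h.ctx rfl
  have hsX := sharp_form_crisp hX
  have hsY := sharp_form_crisp hY
  have hF : Derivable R (ty _ [] (pi (cvar 4) (sharp (cvar 3))) (univ l)) :=
    arrow_form h hX hsY fun _ _ _ => rfl
  have ha : Derivable R (ty _ [] (cvar 2) (arrow (cvar 4) (sharp (cvar 3)))) :=
    ty_cvar (i := 2) h.ctx rfl
  have hb : Derivable R (ty _ [] (cvar 1) (arrow (cvar 4) (sharp (cvar 3)))) :=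
    ty_cvar (i := 1) h.ctx rfl
  have hq : Derivable R (ty _ [] (cvar 0) _) := ty_cvar (i := 0) h.ctx rfl
  have c1 := ctx_coh h.ctx hsX
  have c2 := ctx_coh c1 (wkn h.ctx hF c1)
  have c3 := ctx_coh c2 (wkn h.ctx hF c2)
  have hI := id_form (wkn h.ctx hF c3) (ty_var c3 (j := 1) rfl) (ty_var c3 (j := 0) rfl)
  have c4 := ctx_coh c3 hI
  have k1 := h.cons hsX fun _ _ _ => rfl
  have hF1 := Derivable.cwk k1.ctx hF
  have k2 := k1.cons hF1 fun _ _ _ => rfl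
  have hF2 := Derivable.cwk k2.ctx hF1
  have k3 := k2.cons hF2 fun _ _ _ => rfl
  have hF3 := Derivable.cwk k3.ctx hF2
  have k4 := k3.cons (id_form hF3 (ty_cvar k3.ctx (i := 1) rfl) (ty_cvar k3.ctx (i := 0) rfl))
    fun _ _ _ => rfl
  have key : ∀ {Δ : Zone S} {x f n m : ℕ}, Derivable R (ctx Δ []) →
      Derivable R (ty Δ [] (cvar x) (sharp (cvar n))) →
      Derivable R (ty Δ [] (cvar f) (arrow (cvar n) (sharp (cvar m)))) →
      Derivable R (ty Δ [] (sharpE (app (cvar f) (sharpE (cvar x)))) (cvar m)) :=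
    fun c hx hf => sharp_elim c (app_ty hf (sharp_elim c hx))
  -- The cohesive zone of the motive consists of `z`, `f`, `g` and the path. Below `sharpI` these
  -- four become the crisp variables `3`, `2`, `1`, `0`, which moves `X` and `Y` from `4` and `3` to
  -- `8` and `7`.
  have hC := id_form (wkn h.ctx hsY c4)
    (sharp_intro (M := sharpE (app (var 2) (sharpE (var 3)))) (A := cvar 3)
      (key (n := 8) (m := 7) k4.ctx (ty_cvar k4.ctx (i := 3) rfl) (ty_cvar k4.ctx (i := 2) rfl)))
    (sharp_intro (M := sharpE (app (var 1) (sharpE (var 3)))) (A := cvar 3)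
      (key (n := 8) (m := 7) k4.ctx (ty_cvar k4.ctx (i := 3) rfl) (ty_cvar k4.ctx (i := 1) rfl)))
  have hd := id_intro (sharp_intro (Γ := [pi (cvar 4) (sharp (cvar 3)), sharp (cvar 4)])
    (M := sharpE (app (var 0) (sharpE (var 1)))) (A := cvar 3)
      (key (n := 6) (m := 5) k2.ctx (ty_cvar k2.ctx (i := 1) rfl) (ty_cvar k2.ctx (i := 0) rfl)))
  exact ⟨_, id_elim hC hd (wkn h.ctx ha c1) (wkn h.ctx hb c1)
    (wkn h.ctx (funext_intro ha hb hq) c1)⟩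

/-- A function `a : X → ♯ Y` extends to `♯ X` by `z ↦ ((a (z_♯))_♯)^♯`; pointwise identified
functions have identified extensions. This gives access to `♭`-induction below `♯` when `X` is a
type `♭ A`. -/
theorem sharp_ext {Δ : Zone S} {X Y a b q : Tm S} {l : ℕ} (h : ClosedCtx R Δ)
    (hX : Derivable R (ty Δ [] X (univ l))) (hX' : CohClosed X)
    (hY : Derivable R (ty Δ [] Y (univ l))) (hY' : CohClosed Y)
    (ha : Derivable R (ty Δ [] a (arrow X (sharp Y)))) (ha' : CohClosed a)
    (hb : Derivable R (ty Δ [] b (arrow X (sharp Y)))) (hb' : CohClosed b)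
    (hq : Derivable R (ty Δ [] q (pi X (id (sharp Y) (app a (var 0)) (app b (var 0)))))) :
    ∃ w, Derivable R (ty Δ [sharp X] w (id (sharp Y) (sharpI (sharpE (app a (sharpE (var 0)))))
      (sharpI (sharpE (app b (sharpE (var 0))))))) := by
  obtain ⟨w, hw⟩ := homotopyCtx_sharp_ext (R := R) l
  have c1 := ctx_coh h.ctx (sharp_form_crisp hX)
  have hs : TypedSub R (homotopyCtx S l) Δ
      ⟨fun | 0 => q | 1 => b | 2 => a | 3 => Y | 4 => X | i + 5 => cvar i, var⟩ := by
    refine forall_getElem?_cons ?_ (forall_getElem?_cons ?_ (forall_getElem?_cons ?_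
      (forall_getElem?_cons hY (forall_getElem?_cons hX forall_getElem?_nil))))
    · change Derivable R (ty Δ [] q (pi X (id (sharp Y.wk) (app a.wk (var 0)) (app b.wk (var 0)))))
      rwa [hY'.wk, ha'.wk, hb'.wk]
    · exact hb
    · exact ha
  refine ⟨_, subst_ty _ c1 hs (forall_getElem?_cons ?_ forall_getElem?_nil) hw⟩
  have := var_zero c1
  rw [hX'.sharp.wk] at this
  exact this

/-! ### `♯ ♭ A ≃ ♯ A` -/

namespace Tm

/-- The function `♯ ♭ A → ♯ A`, `x ↦ ((x_♯)_♭)^♯`, for the `n`-th crisp variable `A`. -/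
def sharpCounit (n : ℕ) : Tm S :=
  lam (sharp (flat (cvar n))) (sharpI (flatE (cvar n) (sharpE (var 0)) (cvar 0)))

/-- The function `♯ A → ♯ ♭ A`, `y ↦ ((y_♯)^♭)^♯`, for the `n`-th crisp variable `A`. -/
def sharpFlatI (n : ℕ) : Tm S := lam (sharp (cvar n)) (sharpI (flatI (sharpE (var 0))))

end Tm

section

variable {Δ Γ : Zone S} {N : Tm S} {l n : ℕ}

theorem sharpCounit_body (h : ClosedCtx R Δ) (hA : Derivable R (ty Δ [] (cvar n) (univ l))) :
    Derivable R (ty Δ [sharp (flat (cvar n))]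
      (sharpI (flatE (cvar n) (sharpE (var 0)) (cvar 0))) (sharp (cvar n))) := by
  have k := h.cons (sharp_form_crisp (flat_form h.ctx hA)) fun _ _ _ => rfl
  exact sharp_intro_single (counit_ty k k.ctx (n := n + 1) (Derivable.cwk k.ctx hA)
    (sharp_elim k.ctx (cvar_zero k.ctx)))

theorem sharpCounit_ty (h : ClosedCtx R Δ) (hA : Derivable R (ty Δ [] (cvar n) (univ l))) :
    Derivable R (ty Δ [] (sharpCounit n) (arrow (sharp (flat (cvar n))) (sharp (cvar n)))) :=
  pi_intro (sharpCounit_body h hA)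

theorem sharpCounit_beta (h : ClosedCtx R Δ) (hΓ : Derivable R (ctx Δ Γ))
    (hA : Derivable R (ty Δ [] (cvar n) (univ l)))
    (hN : Derivable R (ty Δ Γ N (sharp (flat (cvar n))))) :
    Derivable R (eq Δ Γ (app (sharpCounit n) N) (sharpI (flatE (cvar n) (sharpE N) (cvar 0)))
      (sharp (cvar n))) :=
  pi_beta (weaken (Γ' := Γ) h.ctx (sharpCounit_body h hA)
    (ctx_coh hΓ (wkn h.ctx (sharp_form_crisp (flat_form h.ctx hA)) hΓ))) hN

theorem sharpFlatI_body (h : ClosedCtx R Δ) (hA : Derivable R (ty Δ [] (cvar n) (univ l))) :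
    Derivable R (ty Δ [sharp (cvar n)] (sharpI (flatI (sharpE (var 0))))
      (sharp (flat (cvar n)))) := by
  have k := h.cons (sharp_form_crisp hA) fun _ _ _ => rfl
  exact sharp_intro_single (flat_intro k.ctx (sharp_elim k.ctx (cvar_zero k.ctx)))

theorem sharpFlatI_ty (h : ClosedCtx R Δ) (hA : Derivable R (ty Δ [] (cvar n) (univ l))) :
    Derivable R (ty Δ [] (sharpFlatI n) (arrow (sharp (cvar n)) (sharp (flat (cvar n))))) :=
  pi_intro (sharpFlatI_body h hA)

theorem sharpFlatI_beta (h : ClosedCtx R Δ) (hΓ : Derivable R (ctx Δ Γ))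
    (hA : Derivable R (ty Δ [] (cvar n) (univ l))) (hN : Derivable R (ty Δ Γ N (sharp (cvar n)))) :
    Derivable R (eq Δ Γ (app (sharpFlatI n) N) (sharpI (flatI (sharpE N)))
      (sharp (flat (cvar n)))) :=
  pi_beta (weaken (Γ' := Γ) h.ctx (sharpFlatI_body h hA)
    (ctx_coh hΓ (wkn h.ctx (sharp_form_crisp hA) hΓ))) hN

/-- This composite is the identity judgmentally: below `♯` the argument `y_♯` is crisp, the `β`
rules give `((y_♯)^♭)_♭ ≡ y_♯`, and `(y_♯)^♯ ≡ y`. -/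
theorem sharpCounit_sharpFlatI (h : ClosedCtx R Δ)
    (hA : Derivable R (ty Δ [] (cvar n) (univ l))) : ∃ H, Derivable R (ty Δ [] H
      (pi (sharp (cvar n)) (id (sharp (cvar n)) (app (sharpCounit n) (app (sharpFlatI n) (var 0)))
        (var 0)))) := by
  have hs := sharp_form_crisp hA
  have c := ctx_coh h.ctx hs
  have k := h.cons hs fun _ _ _ => rfl
  have hA1 : Derivable R (ty _ [] (cvar (n + 1)) (univ l)) := Derivable.cwk k.ctx hA
  have v : Derivable R (ty Δ [sharp (cvar n)] (var 0) (sharp (cvar n))) := var_zero c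
  have u : Derivable R (ty _ [] (cvar 0) (sharp (cvar (n + 1)))) := cvar_zero k.ctx
  have t := app_ty (wkn h.ctx (sharpFlatI_ty h hA) c) v
  have e0 := sharp_elim k.ctx u
  have e := eq_trans (counit_eq k hA1 (eq_trans
    (sharp_elim_eq k.ctx (sharpFlatI_beta k k.ctx hA1 u))
    (sharp_beta k.ctx (flat_intro k.ctx e0)))) (counit_beta k hA1 e0)
  exact ⟨_, pi_intro (refl_of_eq (wkn h.ctx hs c) (app_ty (wkn h.ctx (sharpCounit_ty h hA) c) t)
    (eq_trans (sharpCounit_beta h c hA t) (eq_trans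
      (sharp_intro_eq_single (M := flatE (cvar n) (sharpE (app (sharpFlatI n) (var 0))) (cvar 0))
        (M' := sharpE (var 0)) (A := cvar n) e) (sharp_eta v))))⟩

/-- The function `♭ A → ♯ ♭ A`, `v ↦ ((v_♭)^♭)^♯`, for the `n`-th crisp variable `A`. -/
def Tm.flatCounitSharp (n : ℕ) : Tm S :=
  lam (flat (cvar n)) (sharpI (flatI (flatE (cvar n) (var 0) (cvar 0))))

theorem flatCounitSharp_body (h : ClosedCtx R Δ) (hA : Derivable R (ty Δ [] (cvar n) (univ l))) :
    Derivable R (ty Δ [flat (cvar n)] (sharpI (flatI (flatE (cvar n) (var 0) (cvar 0))))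
      (sharp (flat (cvar n)))) := by
  have k := h.cons (flat_form h.ctx hA) fun _ _ _ => rfl
  exact sharp_intro_single (flat_intro k.ctx (counit_ty (n := n + 1) k k.ctx
    (Derivable.cwk k.ctx hA) (cvar_zero k.ctx)))

theorem sharpI_body {X : Tm S} (h : ClosedCtx R Δ) (hX : Derivable R (ty Δ [] X (univ l)))
    (hX' : CohClosed X) : Derivable R (ty Δ [X] (sharpI (var 0)) (sharp X)) := by
  refine sharp_intro_single ?_
  rw [hX'.crispify]
  exact cvar_zero (h.cons hX hX').ctx

/-- The functions `v ↦ ((v_♭)^♭)^♯` and `v ↦ v^♯` on `♭ A` agree at `u^♭`, hence everywhere by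
`♭`-induction. Their extensions to `♯ ♭ A` in the sense of `sharp_ext` are the composite and the
identity. -/
theorem sharpFlatI_sharpCounit (h : ClosedCtx R Δ)
    (hA : Derivable R (ty Δ [] (cvar n) (univ l))) : ∃ H, Derivable R (ty Δ [] H
      (pi (sharp (flat (cvar n))) (id (sharp (flat (cvar n)))
        (app (sharpFlatI n) (app (sharpCounit n) (var 0))) (var 0)))) := by
  have hF := flat_form (Γ := []) h.ctx hA
  have ha : Derivable R (ty Δ [] (flatCounitSharp n)
    (arrow (flat (cvar n)) (sharp (flat (cvar n))))) := pi_intro (flatCounitSharp_body h hA)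
  have hb : Derivable R (ty Δ [] (lam (flat (cvar n)) (sharpI (var 0)))
    (arrow (flat (cvar n)) (sharp (flat (cvar n))))) :=
    pi_intro (sharpI_body h hF fun _ _ _ => rfl)
  have hq : ∃ q, Derivable R (ty Δ [] q (pi (flat (cvar n)) (id (sharp (flat (cvar n)))
      (app (flatCounitSharp n) (var 0)) (app (lam (flat (cvar n)) (sharpI (var 0))) (var 0))))) := by
    have k := h.cons hA fun _ _ _ => rfl
    have hA1 : Derivable R (ty _ [] (cvar (n + 1)) (univ l)) := Derivable.cwk k.ctx hA
    have u := cvar_zero k.ctx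
    have uI := flat_intro k.ctx u
    have c := ctx_coh h.ctx hF
    have v : Derivable R (ty Δ [flat (cvar n)] (var 0) (flat (cvar n))) := var_zero c
    have e1 := pi_beta (flatCounitSharp_body k hA1) uI
    have e2 := pi_beta (sharpI_body k (flat_form k.ctx hA1) fun _ _ _ => rfl) uI
    have e3 := sharp_intro_eq_crisp (flat_intro_eq k.ctx (counit_beta k hA1 u))
    exact ⟨_, flat_homotopy h hA (fun _ _ _ => rfl) (sharp_form_crisp hF) (fun _ _ _ => rfl)
      (app_ty (wkn h.ctx ha c) v) (app_ty (wkn h.ctx hb c) v) rfl rfl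
      (refl_of_eq (sharp_form_crisp (flat_form k.ctx hA1))
        (app_ty (Derivable.cwk k.ctx ha) uI) (eq_trans e1 (eq_trans e3 (eq_symm e2))))⟩
  obtain ⟨q, hq⟩ := hq
  obtain ⟨w, hw⟩ := sharp_ext h hF (fun _ _ _ => rfl) hF (fun _ _ _ => rfl) ha
    (fun _ _ _ => rfl) hb (fun _ _ _ => rfl) hq
  have hs := sharp_form_crisp hF
  have c := ctx_coh h.ctx hs
  have k := h.cons hs fun _ _ _ => rfl
  have hA1 : Derivable R (ty _ [] (cvar (n + 1)) (univ l)) := Derivable.cwk k.ctx hA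
  have v : Derivable R (ty Δ [sharp (flat (cvar n))] (var 0) (sharp (flat (cvar n)))) := var_zero c
  have u : Derivable R (ty _ [] (cvar 0) (sharp (flat (cvar (n + 1))))) := cvar_zero k.ctx
  have ue := sharp_elim k.ctx u
  have hF1 := flat_form k.ctx hA1
  have hc := counit_ty k k.ctx hA1 ue
  have e1 := eq_trans (sharp_elim_eq k.ctx (pi_beta (flatCounitSharp_body k hA1) ue))
    (sharp_beta k.ctx (flat_intro k.ctx hc))
  have e2 := eq_trans (sharp_elim_eq k.ctx (pi_beta (sharpI_body k hF1 fun _ _ _ => rfl) ue))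
    (sharp_beta k.ctx ue)
  have e3 := flat_intro_eq k.ctx (eq_trans (sharp_elim_eq k.ctx (sharpCounit_beta k k.ctx hA1 u))
    (sharp_beta k.ctx hc))
  have t := app_ty (wkn h.ctx (sharpCounit_ty h hA) c) v
  -- `E1` and `E2` compute the composite and the identity to the two extensions produced by
  -- `sharp_ext`.
  have E1 := eq_trans (sharpFlatI_beta h c hA t) (sharp_intro_eq_single
    (M := flatI (sharpE (app (sharpCounit n) (var 0))))
    (M' := sharpE (app (flatCounitSharp n) (sharpE (var 0)))) (A := flat (cvar n))
    (eq_trans e3 (eq_symm e1)))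
  have E2 := eq_trans (sharp_intro_eq_single
    (M := sharpE (app (lam (flat (cvar n)) (sharpI (var 0))) (sharpE (var 0))))
    (M' := sharpE (var 0)) (A := flat (cvar n)) e2) (sharp_eta v)
  exact ⟨_, pi_intro (ty_conv hw (id_form_eq (eq_refl (wkn h.ctx hs c)) (eq_symm E1) E2))⟩

theorem sharp_flat_isCrispEquivalence (h : ClosedCtx R Δ)
    (hA : Derivable R (ty Δ [] (cvar n) (univ l))) :
    IsCrispEquivalence R Δ (sharp (flat (cvar n))) (sharp (cvar n)) (sharpCounit n) := by
  obtain ⟨H, hH⟩ := sharpCounit_sharpFlatI h hA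
  obtain ⟨K, hK⟩ := sharpFlatI_sharpCounit h hA
  exact ⟨sharpCounit_ty h hA, _, isEquiv_intro h (sharp_form_crisp (flat_form h.ctx hA))
    (fun _ _ _ => rfl) (sharp_form_crisp hA) (fun _ _ _ => rfl) (sharpCounit_ty h hA)
    (fun _ _ _ => rfl) (sharpFlatI_ty h hA) (fun _ _ _ => rfl) hH hK⟩

end

/-! ### Naturality of `♯ ♭ A ≃ ♯ A`. -/

section

variable {Δ Γ : Zone S} {N a : Tm S} {l n m i : ℕ}

/-- For crisp variables `flatMap` unfolds to a `letFlat`, so typing and computation are inherited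
from there. -/
theorem flatMap_cvar_ty (h : ClosedCtx R Δ) (hA : Derivable R (ty Δ [] (cvar n) (univ l)))
    (hB : Derivable R (ty Δ [] (cvar m) (univ l)))
    (hf : Derivable R (ty Δ [] (cvar i) (arrow (cvar n) (cvar m)))) :
    Derivable R (ty Δ [] (flatMap (cvar n) (cvar m) (cvar i))
      (arrow (flat (cvar n)) (flat (cvar m)))) := by
  have k := h.cons hA fun _ _ _ => rfl
  exact letFlat_ty (t := app (cvar (i + 1)) (cvar 0)) h hA (fun _ _ _ => rfl) hB
    (fun _ _ _ => rfl) (app_ty (X := cvar (n + 1)) (Derivable.cwk k.ctx hf) (cvar_zero k.ctx))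

theorem flatMap_cvar_beta (h : ClosedCtx R Δ) (hA : Derivable R (ty Δ [] (cvar n) (univ l)))
    (hB : Derivable R (ty Δ [] (cvar m) (univ l)))
    (hf : Derivable R (ty Δ [] (cvar i) (arrow (cvar n) (cvar m))))
    (ha : Derivable R (ty Δ [] a (cvar n))) :
    Derivable R (eq Δ [] (app (flatMap (cvar n) (cvar m) (cvar i)) (flatI a))
      (flatI (app (cvar i) a)) (flat (cvar m))) := by
  have k := h.cons hA fun _ _ _ => rfl
  exact letFlat_beta (t := app (cvar (i + 1)) (cvar 0)) h hA (fun _ _ _ => rfl) hB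
    (fun _ _ _ => rfl) (app_ty (X := cvar (n + 1)) (Derivable.cwk k.ctx hf) (cvar_zero k.ctx))
    (fun _ _ _ => rfl) ha

/-- The two sides of the square are the extensions to `♯ ♭ A` of `v ↦ ((♭ f v)_♭)^♯` and `v ↦ (f
(v_♭))^♯`. These agree at `v = u^♭`, where both compute to `(f u)^♯`, so `sharp_ext` applies. -/
theorem sharp_flat_square (h : ClosedCtx R Δ) (hA : Derivable R (ty Δ [] (cvar n) (univ l)))
    (hB : Derivable R (ty Δ [] (cvar m) (univ l)))
    (hf : Derivable R (ty Δ [] (cvar i) (arrow (cvar n) (cvar m)))) :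
    CommutesCrisply R Δ (sharp (flat (cvar n))) (sharp (cvar m)) (sharpCounit n) (sharpCounit m)
      (sharpMap (flat (cvar n)) (flatMap (cvar n) (cvar m) (cvar i)))
      (sharpMap (cvar n) (cvar i)) := by
  have hF := flat_form (Γ := []) h.ctx hA
  -- Stated over any closed context: it is needed over `Δ` and over its extensions by `u :: A` and
  -- by a crisp variable of type `♯ ♭ A`.
  have body₁ : ∀ {Δ : Zone S} {n m i : ℕ}, ClosedCtx R Δ →
      Derivable R (ty Δ [] (cvar n) (univ l)) → Derivable R (ty Δ [] (cvar m) (univ l)) →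
      Derivable R (ty Δ [] (cvar i) (arrow (cvar n) (cvar m))) →
      Derivable R (ty Δ [flat (cvar n)]
        (sharpI (flatE (cvar m) (app (flatMap (cvar n) (cvar m) (cvar i)) (var 0)) (cvar 0)))
        (sharp (cvar m))) := by
    intro Δ n m i h hA hB hf
    have k := h.cons (flat_form h.ctx hA) fun _ _ _ => rfl
    have hA1 : Derivable R (ty _ [] (cvar (n + 1)) (univ l)) := Derivable.cwk k.ctx hA
    have hB1 : Derivable R (ty _ [] (cvar (m + 1)) (univ l)) := Derivable.cwk k.ctx hB
    have hf1 : Derivable R (ty _ [] (cvar (i + 1)) (arrow (cvar (n + 1)) (cvar (m + 1)))) :=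
      Derivable.cwk k.ctx hf
    exact sharp_intro_single (counit_ty k k.ctx hB1
      (app_ty (flatMap_cvar_ty k hA1 hB1 hf1) (cvar_zero k.ctx)))
  have body₂ : ∀ {Δ : Zone S} {n m i : ℕ}, ClosedCtx R Δ →
      Derivable R (ty Δ [] (cvar n) (univ l)) →
      Derivable R (ty Δ [] (cvar i) (arrow (cvar n) (cvar m))) →
      Derivable R (ty Δ [flat (cvar n)]
        (sharpI (app (cvar i) (flatE (cvar n) (var 0) (cvar 0)))) (sharp (cvar m))) := by
    intro Δ n m i h hA hf
    have k := h.cons (flat_form h.ctx hA) fun _ _ _ => rfl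
    have hA1 : Derivable R (ty _ [] (cvar (n + 1)) (univ l)) := Derivable.cwk k.ctx hA
    have hf1 : Derivable R (ty _ [] (cvar (i + 1)) (arrow (cvar (n + 1)) (cvar (m + 1)))) :=
      Derivable.cwk k.ctx hf
    exact sharp_intro_single (M := app (cvar i) (flatE (cvar n) (var 0) (cvar 0))) (A := cvar m)
      (app_ty hf1 (counit_ty k k.ctx hA1 (cvar_zero k.ctx)))
  have ha : Derivable R (ty Δ [] (lam _ _) (arrow (flat (cvar n)) (sharp (cvar m)))) :=
    pi_intro (body₁ h hA hB hf)
  have hb : Derivable R (ty Δ [] (lam _ _) (arrow (flat (cvar n)) (sharp (cvar m)))) :=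
    pi_intro (body₂ h hA hf)
  have hq : ∃ q, Derivable R (ty Δ [] q (pi (flat (cvar n)) (id (sharp (cvar m))
      (app (lam (flat (cvar n)) (sharpI (flatE (cvar m)
        (app (flatMap (cvar n) (cvar m) (cvar i)) (var 0)) (cvar 0)))) (var 0))
      (app (lam (flat (cvar n)) (sharpI (app (cvar i) (flatE (cvar n) (var 0) (cvar 0)))))
        (var 0))))) := by
    have k := h.cons hA fun _ _ _ => rfl
    have hA1 : Derivable R (ty _ [] (cvar (n + 1)) (univ l)) := Derivable.cwk k.ctx hA
    have hB1 : Derivable R (ty _ [] (cvar (m + 1)) (univ l)) := Derivable.cwk k.ctx hB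
    have hf1 : Derivable R (ty _ [] (cvar (i + 1)) (arrow (cvar (n + 1)) (cvar (m + 1)))) :=
      Derivable.cwk k.ctx hf
    have u : Derivable R (ty _ [] (cvar 0) (cvar (n + 1))) := cvar_zero k.ctx
    have uI := flat_intro k.ctx u
    have c := ctx_coh h.ctx hF
    have v : Derivable R (ty Δ [flat (cvar n)] (var 0) (flat (cvar n))) := var_zero c
    have e1 := eq_trans (pi_beta (body₁ k hA1 hB1 hf1) uI) (sharp_intro_eq_crisp (eq_trans
      (counit_eq k hB1 (flatMap_cvar_beta k hA1 hB1 hf1 u)) (counit_beta k hB1 (app_ty hf1 u))))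
    have e2 := eq_trans (pi_beta (body₂ k hA1 hf1) uI) (sharp_intro_eq_crisp
      (app_eq (eq_refl hf1) (counit_beta k hA1 u)))
    exact ⟨_, flat_homotopy h hA (fun _ _ _ => rfl) (sharp_form_crisp hB) (fun _ _ _ => rfl)
      (app_ty (wkn h.ctx ha c) v) (app_ty (wkn h.ctx hb c) v) rfl rfl
      (refl_of_eq (sharp_form_crisp hB1)
        (app_ty (Derivable.cwk k.ctx ha) uI) (eq_trans e1 (eq_symm e2)))⟩
  obtain ⟨q, hq⟩ := hq
  obtain ⟨w, hw⟩ := sharp_ext h hF (fun _ _ _ => rfl) hB (fun _ _ _ => rfl) ha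
    (fun _ _ _ => rfl) hb (fun _ _ _ => rfl) hq
  have hs := sharp_form_crisp hF
  have c := ctx_coh h.ctx hs
  have k := h.cons hs fun _ _ _ => rfl
  have hA1 : Derivable R (ty _ [] (cvar (n + 1)) (univ l)) := Derivable.cwk k.ctx hA
  have hB1 : Derivable R (ty _ [] (cvar (m + 1)) (univ l)) := Derivable.cwk k.ctx hB
  have hf1 : Derivable R (ty _ [] (cvar (i + 1)) (arrow (cvar (n + 1)) (cvar (m + 1)))) :=
    Derivable.cwk k.ctx hf
  have hF1 := flat_form (Γ := []) k.ctx hA1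
  have hG := flat_form (Γ := []) h.ctx hB
  have hg := flatMap_cvar_ty h hA hB hf
  have hg1 := flatMap_cvar_ty k hA1 hB1 hf1
  have v : Derivable R (ty Δ [sharp (flat (cvar n))] (var 0) (sharp (flat (cvar n)))) := var_zero c
  have u : Derivable R (ty _ [] (cvar 0) (sharp (flat (cvar (n + 1))))) := cvar_zero k.ctx
  have ue := sharp_elim k.ctx u
  have hc := counit_ty k k.ctx hA1 ue
  have hd := app_ty hg1 ue
  have e1 := eq_trans (sharp_elim_eq k.ctx (pi_beta (body₁ k hA1 hB1 hf1) ue))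
    (sharp_beta k.ctx (counit_ty k k.ctx hB1 hd))
  have e2 := eq_trans (sharp_elim_eq k.ctx (pi_beta (body₂ k hA1 hf1) ue))
    (sharp_beta k.ctx (app_ty hf1 hc))
  have e3 := counit_eq k hB1 (eq_trans (sharp_elim_eq k.ctx (sharpMap_beta k k.ctx hF1
    (fun _ _ _ => rfl) (fun _ _ _ => rfl) hg1 (fun _ _ _ => rfl) u)) (sharp_beta k.ctx hd))
  have e4 := app_eq (eq_refl hf1) (eq_trans (sharp_elim_eq k.ctx (sharpCounit_beta k k.ctx hA1 u))
    (sharp_beta k.ctx hc))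
  have t1 := app_ty (wkn h.ctx (sharpMap_ty h hF (fun _ _ _ => rfl) (fun _ _ _ => rfl) hg
    (fun _ _ _ => rfl)) c) v
  have t2 := app_ty (wkn h.ctx (sharpCounit_ty h hA) c) v
  have E1 := eq_trans (sharpCounit_beta h c hB t1) (sharp_intro_eq_single
    (M := flatE (cvar m) (sharpE (app (sharpMap (flat (cvar n))
      (flatMap (cvar n) (cvar m) (cvar i))) (var 0))) (cvar 0))
    (M' := sharpE (app (lam (flat (cvar n)) (sharpI (flatE (cvar m)
        (app (flatMap (cvar n) (cvar m) (cvar i)) (var 0)) (cvar 0)))) (sharpE (var 0))))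
    (A := cvar m) (eq_trans e3 (eq_symm e1)))
  have E2 := eq_trans (sharpMap_beta h c hA (fun _ _ _ => rfl) (fun _ _ _ => rfl) hf
    (fun _ _ _ => rfl) t2) (sharp_intro_eq_single
    (M := app (cvar i) (sharpE (app (sharpCounit n) (var 0))))
    (M' := sharpE (app (lam (flat (cvar n)) (sharpI (app (cvar i)
      (flatE (cvar n) (var 0) (cvar 0))))) (sharpE (var 0))))
    (A := cvar m) (eq_trans e4 (eq_symm e2)))
  exact ⟨_, pi_intro (ty_conv hw (id_form_eq (eq_refl (wkn h.ctx (sharp_form_crisp hB) c))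
    (eq_symm E1) (eq_symm E2)))⟩

end

/-- `♯ ♭ A ≃ ♯ A`, naturally in crisp `A`. -/
theorem exists_sharp_flat_equivalence (l : ℕ) : ∃ φ : Tm S,
    (∀ Δ A, IsCrispCtx R Δ → Crisp R Δ A (univ l) →
      IsCrispEquivalence R Δ (sharp (flat A)) (sharp A) (φ.cinst A)) ∧
    (∀ Δ A A' f, IsCrispCtx R Δ → Crisp R Δ A (univ l) → Crisp R Δ A' (univ l) →
      Crisp R Δ f (arrow A A') →
      CommutesCrisply R Δ (sharp (flat A)) (sharp A') (φ.cinst A) (φ.cinst A')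
        (sharpMap (flat A) (flatMap A A' f)) (sharpMap A f)) := by
  refine ⟨sharpCounit 0, ?_, ?_⟩
  · intro Δ A hΔ hA
    have hs : TypedSub R [univ l] Δ ⟨fun | 0 => A | i + 1 => cvar i, var⟩ :=
      forall_getElem?_cons hA forall_getElem?_nil
    exact hs.isCrispEquivalence hΔ (sharp_flat_isCrispEquivalence (n := 0) (ClosedCtx.univ l)
      (cvar_zero (ClosedCtx.univ l).ctx))
  · intro Δ A A' f hΔ hA hA' hf
    have hs : TypedSub R [arrow (cvar 1) (cvar 0), univ l, univ l] Δ
        ⟨fun | 0 => f | 1 => A' | 2 => A | i + 3 => cvar i, var⟩ :=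
      forall_getElem?_cons hf (forall_getElem?_cons hA' (forall_getElem?_cons hA
        forall_getElem?_nil))
    have h : ClosedCtx R _ := ClosedCtx.univ_univ_arrow l
    have := hs.commutesCrisply hΔ (sharp_flat_square (n := 2) (m := 1) (i := 0) h
      (ty_cvar (i := 2) h.ctx rfl) (ty_cvar (i := 1) h.ctx rfl) (ty_cvar (i := 0) h.ctx rfl))
    rw [sharpMap_subst, sharpMap_subst, flatMap_subst] at this
    exact this

/-! ### The action of `♭` on crisp identifications -/

/-- Two elements of a type and an identification between them. -/
def pathCtx (S : Signature) (l : ℕ) : Zone S :=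
  [id (cvar 2) (cvar 1) (cvar 0), cvar 1, cvar 0, univ l]

theorem ClosedCtx.pathCtx (l : ℕ) : ClosedCtx R (pathCtx S l) := by
  have h1 : ClosedCtx R _ := ClosedCtx.univ l
  have h2 := h1.cons (ty_cvar (i := 0) h1.ctx rfl) fun _ _ _ => rfl
  have h3 := h2.cons (ty_cvar (i := 1) h2.ctx rfl) fun _ _ _ => rfl
  exact h3.cons (id_form (ty_cvar (i := 2) h3.ctx rfl) (ty_cvar (i := 1) h3.ctx rfl)
    (ty_cvar (i := 0) h3.ctx rfl)) fun _ _ _ => rfl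

/-- Path induction with motive `x^♭ = y^♭` is ill-typed for cohesive `x`, `y`, but `♯ (x^♭ = y^♭)`
is a type, since `♯` makes them crisp. Applied to crisp endpoints and a crisp path, the result is
crisp and can be taken out of `♯`. -/
theorem pathCtx_flat_ap (l : ℕ) : ∃ w : Tm S, Derivable R (ty (pathCtx S l) [] w
    (id (flat (cvar 3)) (flatI (cvar 2)) (flatI (cvar 1)))) := by
  have h : ClosedCtx R (pathCtx S l) := ClosedCtx.pathCtx l
  have hX : Derivable R (ty _ [] (cvar 3) (univ l)) := ty_cvar (i := 3) h.ctx rfl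
  have k1 := h.cons hX fun _ _ _ => rfl
  have hX1 := Derivable.cwk k1.ctx hX
  have k2 := k1.cons hX1 fun _ _ _ => rfl
  have hX2 := Derivable.cwk k2.ctx hX1
  have k3 := k2.cons (id_form hX2 (ty_cvar k2.ctx (i := 1) rfl) (ty_cvar k2.ctx (i := 0) rfl))
    fun _ _ _ => rfl
  have hX3 := Derivable.cwk k3.ctx hX2
  have hC := sharp_form (Γ := [id (cvar 3) (var 1) (var 0), cvar 3, cvar 3])
    (A := id (flat (cvar 3)) (flatI (var 2)) (flatI (var 1)))
    (id_form (flat_form k3.ctx hX3) (flat_intro k3.ctx (ty_cvar k3.ctx (i := 2) rfl))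
      (flat_intro k3.ctx (ty_cvar k3.ctx (i := 1) rfl)))
  have hd := sharp_intro (Γ := [cvar 3]) (M := refl (flatI (var 0)))
    (A := id (flat (cvar 3)) (flatI (var 0)) (flatI (var 0)))
    (id_intro (flat_intro k1.ctx (cvar_zero k1.ctx)))
  exact ⟨_, sharp_elim h.ctx (id_elim hC hd (ty_cvar (i := 2) h.ctx rfl)
    (ty_cvar (i := 1) h.ctx rfl) (ty_cvar (i := 0) h.ctx rfl))⟩

theorem flat_ap {Δ : Zone S} {X a b p : Tm S} {l : ℕ} (h : IsCrispCtx R Δ)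
    (hX : Derivable R (ty Δ [] X (univ l))) (ha : Derivable R (ty Δ [] a X))
    (hb : Derivable R (ty Δ [] b X)) (hp : Derivable R (ty Δ [] p (id X a b))) :
    ∃ w, Derivable R (ty Δ [] w (id (flat X) (flatI a) (flatI b))) := by
  obtain ⟨w, hw⟩ := pathCtx_flat_ap (R := R) l
  have hs : TypedSub R (pathCtx S l) Δ
      ⟨fun | 0 => p | 1 => b | 2 => a | 3 => X | i + 4 => cvar i, var⟩ :=
    forall_getElem?_cons hp (forall_getElem?_cons hb (forall_getElem?_cons ha
      (forall_getElem?_cons hX forall_getElem?_nil)))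
  exact ⟨_, hs.crisp h hw⟩

/-! ### `♭ (Π (u : ♭ A), B (u_♭)) ≃ ♭ (Π (x : A), ♯ (B x))` -/

namespace Tm

/-- The value at `a` of the family given by the `m`-th crisp variable `B`: this is `B a` if `B` is
a dependent type, and `B` if it is a type. -/
def fam (d : Bool) (m : ℕ) (a : Tm S) : Tm S := if d then app (cvar m) a else cvar m

/-- The type of the variable `B` in `fam`, over the `n`-th crisp variable. -/
def famTy (S : Signature) (d : Bool) (n l : ℕ) : Tm S :=
  if d then pi (cvar n) (univ l) else univ l

/-- The type `Π (u : ♭ A), B (u_♭)`. -/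
def piFlat (S : Signature) (d : Bool) (n m : ℕ) : Tm S :=
  pi (flat (cvar n)) (fam d m (flatE (cvar n) (var 0) (cvar 0)))

/-- The type `Π (x : A), ♯ (B x)`. -/
def piToSharp (S : Signature) (d : Bool) (n m : ℕ) : Tm S :=
  pi (cvar n) (sharp (fam d m (var 0)))

/-- The function `λ x, (k (x^♭))^♯` for a crisp function `k` on `♭ A`. -/
def toSharp (n : ℕ) (k : Tm S) : Tm S := lam (cvar n) (sharpI (app k (flatI (var 0))))

/-- The function `λ u, let x^♭ := u in (h x)_♯` for a crisp function `h` on `A`. -/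
def ofSharp (d : Bool) (n m : ℕ) (h : Tm S) : Tm S :=
  lam (flat (cvar n)) (flatE (fam d m (flatE (cvar n) (var 0) (cvar 0))) (var 0)
    (sharpE (app h.cwk (cvar 0))))

theorem fam_inst (d : Bool) (m : ℕ) (t a : Tm S) : (fam d m t).inst a = fam d m (t.inst a) := by
  cases d <;> rfl

theorem fam_instFlatVar (d : Bool) (m : ℕ) (t : Tm S) :
    (fam d m t).instFlatVar = fam d (m + 1) t.instFlatVar := by
  cases d <;> rfl

theorem fam_crispify (d : Bool) (m : ℕ) (t : Tm S) :
    (fam d m t).crispify 1 = fam d (m + 1) (t.crispify 1) := by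
  cases d <;> rfl

theorem piFlat_cwk (d : Bool) (n m : ℕ) : (piFlat S d n m).cwk = piFlat S d (n + 1) (m + 1) := by
  cases d <;> rfl

theorem piToSharp_cwk (d : Bool) (n m : ℕ) :
    (piToSharp S d n m).cwk = piToSharp S d (n + 1) (m + 1) := by
  cases d <;> rfl

theorem cohClosed_piFlat (d : Bool) (n m : ℕ) : CohClosed (piFlat S d n m) := by
  cases d <;> exact fun _ _ _ => rfl

theorem cohClosed_piToSharp (d : Bool) (n m : ℕ) : CohClosed (piToSharp S d n m) := by
  cases d <;> exact fun _ _ _ => rfl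

theorem cohClosed_ofSharp_cvar (d : Bool) (n m i : ℕ) :
    CohClosed (ofSharp d n m (cvar i) : Tm S) := by
  cases d <;> exact fun _ _ _ => rfl

end Tm

/-- The `n`-th variable of `Δ` is a type, and the `m`-th is a type or a family over it. -/
structure FamCtx (R : Set (List (Judgment S) × Judgment S)) (Δ : Zone S) (d : Bool) (n m l : ℕ) :
    Prop where
  closed : ClosedCtx R Δ
  base : Derivable R (ty Δ [] (cvar n) (univ l))
  family : Derivable R (ty Δ [] (cvar m) (famTy S d n l))

namespace FamCtx

variable {Δ Γ : Zone S} {d : Bool} {n m l l' j : ℕ} {X a a' k h N : Tm S}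

theorem ctx (H : FamCtx R Δ d n m l) : Derivable R (ctx Δ []) := H.closed.ctx

theorem cons (H : FamCtx R Δ d n m l) (hX : Derivable R (ty Δ [] X (univ l')))
    (hX' : CohClosed X) : FamCtx R (X :: Δ) d (n + 1) (m + 1) l := by
  have c := H.closed.cons hX hX'
  refine ⟨c, Derivable.cwk c.ctx H.base, ?_⟩
  have := Derivable.cwk c.ctx H.family
  cases d <;> exact this

theorem cons_base (H : FamCtx R Δ d n m l) : FamCtx R (cvar n :: Δ) d (n + 1) (m + 1) l :=
  H.cons H.base fun _ _ _ => rfl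

theorem fam_ty (H : FamCtx R Δ d n m l) (hΓ : Derivable R (Judgment.ctx Δ Γ))
    (ha : Derivable R (ty Δ Γ a (cvar n))) : Derivable R (ty Δ Γ (fam d m a) (univ l)) := by
  have hB := wkn H.ctx H.family hΓ
  cases d
  · exact hB
  · exact pi_elim hB ha

theorem fam_eq (H : FamCtx R Δ d n m l) (hΓ : Derivable R (Judgment.ctx Δ Γ))
    (ha : Derivable R (eq Δ Γ a a' (cvar n))) :
    Derivable R (eq Δ Γ (fam d m a) (fam d m a') (univ l)) := by
  have hB := eq_refl (wkn H.ctx H.family hΓ)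
  cases d
  · exact hB
  · exact pi_elim_eq hB ha

/-- The conversion `B ((a^♭)_♭) ≡ B a`, by which values `k (a^♭)` are typed in `B a`. -/
theorem fam_counit (H : FamCtx R Δ d n m l) (ha : Derivable R (ty Δ [] a (cvar n))) :
    Derivable R (eq Δ [] (fam d m (flatE (cvar n) (flatI a) (cvar 0))) (fam d m a) (univ l)) :=
  H.fam_eq H.ctx (counit_beta H.closed H.base ha)

theorem fam_counit_var_ty (H : FamCtx R Δ d n m l) : Derivable R (ty Δ [flat (cvar n)]
    (fam d m (flatE (cvar n) (var 0) (cvar 0))) (univ l)) :=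
  H.fam_ty (ctx_coh H.ctx (flat_form H.ctx H.base)) (counit_var_ty H.closed H.base)

theorem piFlat_ty (H : FamCtx R Δ d n m l) : Derivable R (ty Δ [] (piFlat S d n m) (univ l)) :=
  pi_form (flat_form H.ctx H.base) H.fam_counit_var_ty

theorem piToSharp_ty (H : FamCtx R Δ d n m l) :
    Derivable R (ty Δ [] (piToSharp S d n m) (univ l)) := by
  refine pi_form H.base (sharp_form_single ?_)
  rw [fam_crispify]
  exact H.cons_base.fam_ty H.cons_base.ctx (cvar_zero H.cons_base.ctx)

theorem cons_piFlat (H : FamCtx R Δ d n m l) :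
    FamCtx R (piFlat S d n m :: Δ) d (n + 1) (m + 1) l :=
  H.cons H.piFlat_ty (cohClosed_piFlat d n m)

theorem cons_piToSharp (H : FamCtx R Δ d n m l) :
    FamCtx R (piToSharp S d n m :: Δ) d (n + 1) (m + 1) l :=
  H.cons H.piToSharp_ty (cohClosed_piToSharp d n m)

theorem piFlat_app (H : FamCtx R Δ d n m l) (hk : Derivable R (ty Δ [] k (piFlat S d n m)))
    (ha : Derivable R (ty Δ [] a (cvar n))) :
    Derivable R (ty Δ [] (app k (flatI a)) (fam d m a)) := by
  have := pi_elim hk (flat_intro H.ctx ha)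
  rw [fam_inst] at this
  exact ty_conv this (H.fam_counit ha)

theorem piToSharp_app (hk : Derivable R (ty Δ Γ k (piToSharp S d n m)))
    (ha : Derivable R (ty Δ Γ a (cvar n))) :
    Derivable R (ty Δ Γ (app k a) (sharp (fam d m a))) := by
  have := pi_elim hk ha
  change Derivable R (ty Δ Γ (app k a) (sharp ((fam d m (var 0)).inst a))) at this
  rw [fam_inst] at this
  exact this

theorem toSharp_body (H : FamCtx R Δ d n m l) (hk : Derivable R (ty Δ [] k (piFlat S d n m)))
    (hk' : CohClosed k) : Derivable R (ty Δ [cvar n] (sharpI (app k (flatI (var 0))))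
      (sharp (fam d m (var 0)))) := by
  refine sharp_intro_single ?_
  rw [fam_crispify]
  change Derivable R (ty _ [] (app (k.crispify 1) (flatI (cvar 0))) _)
  rw [hk'.crispify]
  refine H.cons_base.piFlat_app ?_ (cvar_zero H.cons_base.ctx)
  rw [← piFlat_cwk]
  exact Derivable.cwk H.cons_base.ctx hk

theorem toSharp_ty (H : FamCtx R Δ d n m l) (hk : Derivable R (ty Δ [] k (piFlat S d n m)))
    (hk' : CohClosed k) : Derivable R (ty Δ [] (toSharp n k) (piToSharp S d n m)) :=
  pi_intro (H.toSharp_body hk hk')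

theorem toSharp_beta (H : FamCtx R Δ d n m l) (hk : Derivable R (ty Δ [] k (piFlat S d n m)))
    (hk' : CohClosed k) (ha : Derivable R (ty Δ [] a (cvar n))) :
    Derivable R (eq Δ [] (app (toSharp n k) a) (sharpI (app k (flatI a)))
      (sharp (fam d m a))) := by
  have := pi_beta (H.toSharp_body hk hk') ha
  change Derivable R (eq Δ [] _ (sharpI (app (k.inst a) (flatI a)))
    (sharp ((fam d m (var 0)).inst a))) at this
  rw [fam_inst, hk'.inst] at this
  exact this

theorem sharpE_toSharp (H : FamCtx R Δ d n m l) (hk : Derivable R (ty Δ [] k (piFlat S d n m)))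
    (hk' : CohClosed k) (ha : Derivable R (ty Δ [] a (cvar n))) :
    Derivable R (eq Δ [] (sharpE (app (toSharp n k) a)) (app k (flatI a)) (fam d m a)) :=
  eq_trans (sharp_elim_eq H.ctx (H.toSharp_beta hk hk' ha))
    (sharp_beta H.ctx (H.piFlat_app hk ha))

theorem ofSharp_branch (H : FamCtx R Δ d n m l)
    (hh : Derivable R (ty Δ [] h (piToSharp S d n m))) :
    Derivable R (ty (cvar n :: Δ) [] (sharpE (app h.cwk (cvar 0)))
      (fam d m (flatE (cvar n) (var 0) (cvar 0))).instFlatVar) := by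
  have H1 := H.cons_base
  have u := cvar_zero H1.ctx
  rw [fam_instFlatVar]
  refine ty_conv (sharp_elim H1.ctx (piToSharp_app ?_ u)) (eq_symm (H1.fam_counit u))
  rw [← piToSharp_cwk]
  exact Derivable.cwk H1.ctx hh

theorem ofSharp_body (H : FamCtx R Δ d n m l)
    (hh : Derivable R (ty Δ [] h (piToSharp S d n m))) :
    Derivable R (ty Δ [flat (cvar n)]
      (flatE (fam d m (flatE (cvar n) (var 0) (cvar 0))) (var 0) (sharpE (app h.cwk (cvar 0))))
      (fam d m (flatE (cvar n) (var 0) (cvar 0)))) :=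
  flat_ind H.closed H.base (fun _ _ _ => rfl) H.fam_counit_var_ty (fam_inst d m _ _)
    (H.ofSharp_branch hh)

theorem ofSharp_ty (H : FamCtx R Δ d n m l) (hh : Derivable R (ty Δ [] h (piToSharp S d n m))) :
    Derivable R (ty Δ [] (ofSharp d n m h) (piFlat S d n m)) :=
  pi_intro (H.ofSharp_body hh)

theorem ofSharp_beta (H : FamCtx R Δ d n m l) (hh : Derivable R (ty Δ [] h (piToSharp S d n m)))
    (hh' : CohClosed h) (ha : Derivable R (ty Δ [] a (cvar n))) :
    Derivable R (eq Δ [] (app (ofSharp d n m h) (flatI a)) (sharpE (app h a)) (fam d m a)) := by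
  have e1 := pi_beta (H.ofSharp_body hh) (flat_intro H.ctx ha)
  have e2 := flat_beta (Γ := []) H.fam_counit_var_ty ha (H.ofSharp_branch hh)
  have e3 : (flatE (fam d m (flatE (cvar n) (var 0) (cvar 0))) (var 0)
      (sharpE (app h.cwk (cvar 0)))).inst (flatI a) =
      flatE (fam d m (flatE (cvar n) (var 0) (cvar 0))) (flatI a)
        (sharpE (app h.cwk (cvar 0))) := by
    simp only [Tm.inst, Tm.subst, (hh'.cwkn 1).subst_cup]
    cases d <;> rfl
  change Derivable R (eq Δ [] _ (sharpE (app (h.cwk.cinst a) a)) _) at e2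
  rw [Tm.cwk_cinst] at e2
  rw [e3] at e1
  have e4 := eq_trans e1 e2
  rw [fam_inst] at e4
  exact eq_conv e4 (H.fam_counit ha)

/-- Under `λ` and `♯` the value of `ofSharp` at `x^♭` computes to `(h x)_♯`; the `η` rules of `♯`
and `Π` then recover `h`, with no identification needed. -/
theorem toSharp_ofSharp (H : FamCtx R Δ d n m l)
    (hh : Derivable R (ty Δ [] (cvar j) (piToSharp S d n m))) :
    Derivable R (eq Δ [] (toSharp n (ofSharp d n m (cvar j))) (cvar j) (piToSharp S d n m)) := by
  have c := ctx_coh H.ctx H.base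
  have H1 := H.cons_base
  refine eq_trans (pi_intro_eq (eq_refl H.base) (eq_trans (sharp_intro_eq_single
    (M' := sharpE (app (cvar j) (var 0))) ?_) (sharp_eta ?_))) (eq_symm (pi_eta hh))
  · rw [fam_crispify]
    have := H1.ofSharp_beta (h := cvar (j + 1)) (by
      rw [← piToSharp_cwk]; exact Derivable.cwk H1.ctx hh) (fun _ _ _ => rfl) (cvar_zero H1.ctx)
    cases d <;> exact this
  · exact piToSharp_app (wkn H.ctx hh c) (var_zero c)

/-- Only an identification is available here, since `♭` has no judgmental uniqueness rule: the two
functions are compared at `x^♭` by `♭`-induction and then identified by function extensionality. -/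
theorem ofSharp_toSharp (H : FamCtx R Δ d n m l)
    (hk : Derivable R (ty Δ [] (cvar j) (piFlat S d n m))) : ∃ p, Derivable R (ty Δ [] p
      (id (piFlat S d n m) (ofSharp d n m (toSharp n (cvar j))) (cvar j))) := by
  have H1 := H.cons_base
  have c := ctx_coh H.ctx (flat_form H.ctx H.base)
  have v : Derivable R (ty Δ [flat (cvar n)] (var 0) (flat (cvar n))) := var_zero c
  have hf := H.ofSharp_ty (H.toSharp_ty hk fun _ _ _ => rfl)
  have hk1 : Derivable R (ty (cvar n :: Δ) [] (cvar (j + 1)) (piFlat S d (n + 1) (m + 1))) := by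
    rw [← piFlat_cwk]; exact Derivable.cwk H1.ctx hk
  have hh1 := H1.toSharp_ty hk1 fun _ _ _ => rfl
  have u : Derivable R (ty _ [] (cvar 0) (cvar (n + 1))) := cvar_zero H1.ctx
  have e := eq_trans (H1.ofSharp_beta hh1 (fun _ _ _ => rfl) u)
    (H1.sharpE_toSharp hk1 (fun _ _ _ => rfl) u)
  have e' := eq_conv e (eq_symm (H1.fam_counit u))
  have uI := flat_intro H1.ctx u
  have t := pi_elim (H1.ofSharp_ty hh1) uI
  rw [fam_inst] at t
  have r := refl_of_eq (H1.fam_ty H1.ctx (counit_ty H1.closed H1.ctx H1.base uI)) t e'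
  have t1 := pi_elim (wkn H.ctx hf c) v
  have t2 := pi_elim (wkn H.ctx hk c) v
  rw [fam_inst] at t1 t2
  have hC := id_form H.fam_counit_var_ty t1 t2
  have hC' : (id (fam d m (flatE (cvar n) (var 0) (cvar 0)))
      (app (ofSharp d n m (toSharp n (cvar j))) (var 0)) (app (cvar j) (var 0)) : Tm S).inst
      (var 0) = id (fam d m (flatE (cvar n) (var 0) (cvar 0)))
      (app (ofSharp d n m (toSharp n (cvar j))) (var 0)) (app (cvar j) (var 0)) := by
    cases d <;> rfl
  have hw := flat_ind (N := refl (app (ofSharp d (n + 1) (m + 1) (toSharp (n + 1) (cvar (j + 1))))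
    (flatI (cvar 0)))) H.closed H.base (fun _ _ _ => rfl) hC hC' (by cases d <;> exact r)
  have hw' := pi_intro hw
  -- The rule `funext_intro` asks for the weakened function, and weakening is vacuous here.
  have hf' : (ofSharp d n m (toSharp n (cvar j)) : Tm S).wk = ofSharp d n m (toSharp n (cvar j)) := by
    cases d <;> rfl
  rw [← hf'] at hw'
  exact ⟨_, funext_intro hf hk hw'⟩

theorem isCrispEquivalence (H : FamCtx R Δ d n m l) :
    IsCrispEquivalence R Δ (flat (piFlat S d n m)) (flat (piToSharp S d n m))
      (letFlat (piFlat S d n m) (piToSharp S d n m) (toSharp (n + 1) (cvar 0))) := by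
  have H1 := H.cons_piFlat
  have H2 := H.cons_piToSharp
  have hk : Derivable R (ty (piFlat S d n m :: Δ) [] (cvar 0) (piFlat S d (n + 1) (m + 1))) := by
    rw [← piFlat_cwk]; exact cvar_zero H1.ctx
  have hh : Derivable R (ty (piToSharp S d n m :: Δ) [] (cvar 0) (piToSharp S d (n + 1) (m + 1))) := by
    rw [← piToSharp_cwk]; exact cvar_zero H2.ctx
  have ht := H1.toSharp_ty hk fun _ _ _ => rfl
  have hr := H2.ofSharp_ty hh
  obtain ⟨p, hp⟩ := H1.ofSharp_toSharp hk
  -- The identification of functions has to be moved under `♭`; for the other composite the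
  -- congruence rule of `(-)^♭` suffices.
  obtain ⟨p, hp⟩ := flat_ap H1.ctx H1.piFlat_ty (H1.ofSharp_ty ht) hk hp
  have e := flat_intro_eq H2.ctx (H2.toSharp_ofSharp hh)
  have q := refl_of_eq (flat_form H2.ctx H2.piToSharp_ty) (flat_intro H2.ctx
    (H2.toSharp_ty hr (cohClosed_ofSharp_cvar d _ _ _))) e
  rw [← piToSharp_cwk] at ht
  rw [← piFlat_cwk] at hr
  have cP := cohClosed_piFlat (S := S) d n m
  have cQ := cohClosed_piToSharp (S := S) d n m
  refine ⟨letFlat_ty H.closed H.piFlat_ty cP H.piToSharp_ty cQ ht, ?_⟩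
  refine letFlat_isEquiv (p := p)
    (q := refl (flatI (toSharp (n + 1) (ofSharp d (n + 1) (m + 1) (cvar 0))))) H.closed
    H.piFlat_ty cP H.piToSharp_ty cQ ht (fun _ _ _ => rfl) hr (cohClosed_ofSharp_cvar d _ _ _)
    ?_ ?_
  · rw [piFlat_cwk]
    cases d <;> exact hp
  · rw [piToSharp_cwk]
    cases d <;> exact q

end FamCtx

/-! ### Naturality of `♭ (Π (u : ♭ A), B (u_♭)) ≃ ♭ (Π (x : A), ♯ (B x))` -/

namespace Tm

/-- The value `g x y` of a map of families, or `g y` for a function `g` between types. -/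
def famApp (d : Bool) (j : ℕ) (x y : Tm S) : Tm S :=
  if d then app (app (cvar j) x) y else app (cvar j) y

/-- The type of `g` in `famApp`. -/
def famMapTy (S : Signature) (d : Bool) (m n' m' i : ℕ) : Tm S :=
  if d then pi (cvar n') (arrow (app (cvar m) (app (cvar i) (var 0))) (app (cvar m') (var 0)))
  else arrow (cvar m) (cvar m')

end Tm

/-- Two families as in `FamCtx`, a function `f` between their bases in the opposite direction, and
a map of families over `f`. -/
structure FamMapCtx (R : Set (List (Judgment S) × Judgment S)) (Δ : Zone S) (d : Bool)
    (n m n' m' i j l : ℕ) : Prop where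
  src : FamCtx R Δ d n m l
  tgt : FamCtx R Δ d n' m' l
  map : Derivable R (ty Δ [] (cvar i) (arrow (cvar n') (cvar n)))
  famMap : Derivable R (ty Δ [] (cvar j) (famMapTy S d m n' m' i))

namespace FamMapCtx

variable {Δ Γ : Zone S} {d : Bool} {n m n' m' i j l l' q : ℕ} {X x y y' k h : Tm S}

theorem ctx (H : FamMapCtx R Δ d n m n' m' i j l) : Derivable R (ctx Δ []) := H.src.ctx

theorem cons (H : FamMapCtx R Δ d n m n' m' i j l) (hX : Derivable R (ty Δ [] X (univ l')))
    (hX' : CohClosed X) :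
    FamMapCtx R (X :: Δ) d (n + 1) (m + 1) (n' + 1) (m' + 1) (i + 1) (j + 1) l := by
  have H1 := H.src.cons hX hX'
  refine ⟨H1, H.tgt.cons hX hX', Derivable.cwk H1.ctx H.map, ?_⟩
  have := Derivable.cwk H1.ctx H.famMap
  cases d <;> exact this

theorem famApp_ty (H : FamMapCtx R Δ d n m n' m' i j l) (hΓ : Derivable R (Judgment.ctx Δ Γ))
    (hx : Derivable R (ty Δ Γ x (cvar n')))
    (hy : Derivable R (ty Δ Γ y (fam d m (app (cvar i) x)))) :
    Derivable R (ty Δ Γ (famApp d j x y) (fam d m' x)) := by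
  have hg := wkn H.ctx H.famMap hΓ
  cases d
  · exact app_ty hg hy
  · have := pi_elim (pi_elim hg hx) hy
    change Derivable R (ty Δ Γ _ (app (cvar m') (x.wk.inst y))) at this
    rwa [Tm.wk_inst] at this

theorem famApp_eq (H : FamMapCtx R Δ d n m n' m' i j l) (hΓ : Derivable R (Judgment.ctx Δ Γ))
    (hx : Derivable R (ty Δ Γ x (cvar n')))
    (hy : Derivable R (eq Δ Γ y y' (fam d m (app (cvar i) x)))) :
    Derivable R (eq Δ Γ (famApp d j x y) (famApp d j x y') (fam d m' x)) := by
  have hg := eq_refl (wkn H.ctx H.famMap hΓ)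
  cases d
  · exact app_eq hg hy
  · have := pi_elim_eq (pi_elim_eq hg (eq_refl hx)) hy
    change Derivable R (eq Δ Γ _ _ (app (cvar m') (x.wk.inst y))) at this
    rwa [Tm.wk_inst] at this

/-- Two functions `α` and `β` that act pointwise by `k ↦ λ u, let x^♭ := u in g x (k ((f x)^♭))`
and `h ↦ λ x, (g x (h (f x))_♯)^♯` correspond to each other under `toSharp`. -/
theorem toSharp_natural {u v : Tm S} (H : FamMapCtx R Δ d n m n' m' i j l)
    (hk : Derivable R (ty Δ [] (cvar q) (piFlat S d n m)))
    (hu : Derivable R (eq (cvar n' :: Δ) [] (app (u.crispify 1) (flatI (cvar 0)))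
      (famApp d (j + 1) (cvar 0) (app (cvar (q + 1)) (flatI (app (cvar (i + 1)) (cvar 0)))))
      (fam d (m' + 1) (cvar 0))))
    (hv : Derivable R (eq Δ [cvar n'] v (sharpI (famApp d j (var 0) (sharpE
      (app (toSharp n (cvar q)) (app (cvar i) (var 0)))))) (sharp (fam d m' (var 0))))) :
    Derivable R (eq Δ [] (lam (cvar n') (sharpI (app u (flatI (var 0))))) (lam (cvar n') v)
      (piToSharp S d n' m')) := by
  have H1 := H.cons H.tgt.base fun _ _ _ => rfl
  have hk1 : Derivable R (ty (cvar n' :: Δ) [] (cvar (q + 1)) (piFlat S d (n + 1) (m + 1))) := by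
    rw [← piFlat_cwk]; exact Derivable.cwk H1.ctx hk
  have hx : Derivable R (ty (cvar n' :: Δ) [] (cvar 0) (cvar (n' + 1))) := cvar_zero H1.ctx
  refine pi_intro_eq (eq_refl H.tgt.base) (eq_trans (sharp_intro_eq_single ?_) (eq_symm hv))
  -- Below `♯` the variable `x` is crisp, so `(toSharp k (f x))_♯` computes to `k ((f x)^♭)`.
  have e := eq_trans hu (eq_symm (H1.famApp_eq H1.ctx hx (H1.src.sharpE_toSharp hk1
    (fun _ _ _ => rfl) (app_ty H1.map hx))))
  cases d <;> exact e

end FamMapCtx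

/-! ### The square for non-dependent function types. -/

namespace FamMapCtx

variable {Δ : Zone S} {n m n' m' i j l q : ℕ} {x : Tm S}

theorem flatMap_ty (H : FamMapCtx R Δ false n m n' m' i j l) :
    Derivable R (ty Δ [] (flatMap (cvar n') (cvar n) (cvar i))
      (arrow (flat (cvar n')) (flat (cvar n)))) :=
  flatMap_cvar_ty H.src.closed H.tgt.base H.src.base H.map

theorem homMap_flat_body (H : FamMapCtx R Δ false n m n' m' i j l) :
    Derivable R (ty Δ [piFlat S false n m] (lam (flat (cvar n')) (app (cvar j) (app (var 1)
      (app (flatMap (cvar n') (cvar n) (cvar i)) (var 0))))) (piFlat S false n' m')) := by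
  have c1 := ctx_coh H.ctx H.src.piFlat_ty
  have c2 := ctx_coh c1 (flat_form c1 H.tgt.base)
  have v0 : Derivable R (ty Δ [flat (cvar n'), piFlat S false n m] (var 0) (flat (cvar n'))) :=
    var_zero c2
  have v1 : Derivable R (ty Δ [flat (cvar n'), piFlat S false n m] (var 1)
    (arrow (flat (cvar n)) (cvar m))) := ty_var (j := 1) c2 rfl
  exact pi_intro (app_ty (wkn H.ctx H.famMap c2) (app_ty v1 (app_ty (wkn H.ctx H.flatMap_ty c2) v0)))

theorem homMap_flat_ty (H : FamMapCtx R Δ false n m n' m' i j l) :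
    Derivable R (ty Δ [] (homMap (flat (cvar n)) (cvar m) (flat (cvar n'))
      (flatMap (cvar n') (cvar n) (cvar i)) (cvar j))
      (arrow (piFlat S false n m) (piFlat S false n' m'))) :=
  pi_intro H.homMap_flat_body

theorem homMap_flat_beta (H : FamMapCtx R Δ false n m n' m' i j l)
    (hk : Derivable R (ty Δ [] (cvar q) (piFlat S false n m)))
    (hx : Derivable R (ty Δ [] x (cvar n'))) :
    Derivable R (eq Δ [] (app (app (homMap (flat (cvar n)) (cvar m) (flat (cvar n'))
      (flatMap (cvar n') (cvar n) (cvar i)) (cvar j)) (cvar q)) (flatI x))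
      (app (cvar j) (app (cvar q) (flatI (app (cvar i) x)))) (cvar m')) := by
  have c := ctx_coh H.ctx (flat_form H.ctx H.tgt.base)
  have v : Derivable R (ty Δ [flat (cvar n')] (var 0) (flat (cvar n'))) := var_zero c
  have xI := flat_intro H.ctx hx
  have hk' : Derivable R (ty Δ [] (cvar q) (arrow (flat (cvar n)) (cvar m))) := hk
  have e1 : Derivable R (eq Δ [] _ (lam (flat (cvar n')) (app (cvar j) (app (cvar q)
      (app (flatMap (cvar n') (cvar n) (cvar i)) (var 0))))) (arrow (flat (cvar n')) (cvar m'))) :=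
    pi_beta H.homMap_flat_body hk
  have e2 := pi_beta (app_ty (wkn H.ctx H.famMap c) (app_ty (wkn H.ctx hk' c)
    (app_ty (wkn H.ctx H.flatMap_ty c) v))) xI
  have e3 := app_eq (eq_refl H.famMap) (app_eq (eq_refl hk') (flatMap_cvar_beta H.src.closed
    H.tgt.base H.src.base H.map hx))
  exact eq_trans (app_eq e1 (eq_refl xI)) (eq_trans e2 e3)

theorem sharpMap_ty (H : FamMapCtx R Δ false n m n' m' i j l) :
    Derivable R (ty Δ [] (sharpMap (cvar m) (cvar j)) (arrow (sharp (cvar m)) (sharp (cvar m')))) :=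
  Derivable.sharpMap_ty H.src.closed H.src.family (fun _ _ _ => rfl) (fun _ _ _ => rfl) H.famMap
    fun _ _ _ => rfl

theorem homMap_sharp_body (H : FamMapCtx R Δ false n m n' m' i j l) :
    Derivable R (ty Δ [piToSharp S false n m] (lam (cvar n') (app (sharpMap (cvar m) (cvar j))
      (app (var 1) (app (cvar i) (var 0))))) (piToSharp S false n' m')) := by
  have c1 := ctx_coh H.ctx H.src.piToSharp_ty
  have c2 := ctx_coh c1 (wkn H.ctx H.tgt.base c1)
  have v0 : Derivable R (ty Δ [cvar n', piToSharp S false n m] (var 0) (cvar n')) := var_zero c2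
  have v1 : Derivable R (ty Δ [cvar n', piToSharp S false n m] (var 1)
    (arrow (cvar n) (sharp (cvar m)))) := ty_var (j := 1) c2 rfl
  exact pi_intro (app_ty (wkn H.ctx H.sharpMap_ty c2) (app_ty v1 (app_ty (wkn H.ctx H.map c2) v0)))

theorem homMap_sharp_ty (H : FamMapCtx R Δ false n m n' m' i j l) :
    Derivable R (ty Δ [] (homMap (cvar n) (sharp (cvar m)) (cvar n') (cvar i)
      (sharpMap (cvar m) (cvar j))) (arrow (piToSharp S false n m) (piToSharp S false n' m'))) :=
  pi_intro H.homMap_sharp_body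

/-- Both routes send `k^♭` to `(λ x, (g (k ((f x)^♭)))^♯)^♭`, judgmentally. -/
theorem homMap_square (H : FamMapCtx R Δ false n m n' m' i j l) :
    CommutesCrisply R Δ (flat (piFlat S false n m)) (flat (piToSharp S false n' m'))
      (letFlat (piFlat S false n m) (piToSharp S false n m) (toSharp (n + 1) (cvar 0)))
      (letFlat (piFlat S false n' m') (piToSharp S false n' m') (toSharp (n' + 1) (cvar 0)))
      (flatMap (piFlat S false n m) (piFlat S false n' m') (homMap (flat (cvar n)) (cvar m)
        (flat (cvar n')) (flatMap (cvar n') (cvar n) (cvar i)) (cvar j)))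
      (flatMap (piToSharp S false n m) (piToSharp S false n' m') (homMap (cvar n) (sharp (cvar m))
        (cvar n') (cvar i) (sharpMap (cvar m) (cvar j)))) := by
  have H1 := H.cons H.src.piFlat_ty (cohClosed_piFlat _ _ _)
  have H2 := H.cons H.tgt.piFlat_ty (cohClosed_piFlat _ _ _)
  have H3 := H.cons H.src.piToSharp_ty (cohClosed_piToSharp _ _ _)
  have hk : Derivable R (ty _ [] (cvar 0) (piFlat S false (n + 1) (m + 1))) := cvar_zero H1.ctx
  have hk' : Derivable R (ty _ [] (cvar 0) (piFlat S false (n' + 1) (m' + 1))) := cvar_zero H2.ctx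
  have ht := H1.src.toSharp_ty hk fun _ _ _ => rfl
  have c := ctx_coh H1.ctx H1.tgt.base
  have v : Derivable R (ty _ [cvar (n' + 1)] (var 0) (cvar (n' + 1))) := var_zero c
  have H4 := H1.cons H1.tgt.base fun _ _ _ => rfl
  have ht' : Derivable R (ty _ [] _ (arrow (cvar (n + 1)) (sharp (cvar (m + 1))))) := ht
  have e1 := sharpMap_beta H1.src.closed c H1.src.family (fun _ _ _ => rfl) (fun _ _ _ => rfl)
    H1.famMap (fun _ _ _ => rfl) (app_ty (wkn H1.ctx ht' c) (app_ty (wkn H1.ctx H1.map c) v))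
  have e2 := H1.toSharp_natural (u := app (homMap (flat (cvar (n + 1))) (cvar (m + 1))
    (flat (cvar (n' + 1))) (flatMap (cvar (n' + 1)) (cvar (n + 1)) (cvar (i + 1)))
    (cvar (j + 1))) (cvar 0)) hk
    (H4.homMap_flat_beta (q := 1) (Derivable.cwk H4.ctx hk) (cvar_zero H4.ctx)) e1
  have e3 := pi_beta H1.homMap_sharp_body ht
  exact letFlat_square (a := app (homMap (flat (cvar (n + 1))) (cvar (m + 1))
      (flat (cvar (n' + 1))) (flatMap (cvar (n' + 1)) (cvar (n + 1)) (cvar (i + 1)))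
      (cvar (j + 1))) (cvar 0))
    (b := app (homMap (cvar (n + 1)) (sharp (cvar (m + 1))) (cvar (n' + 1)) (cvar (i + 1))
      (sharpMap (cvar (m + 1)) (cvar (j + 1)))) (cvar 0))
    H.src.closed H.src.piFlat_ty (cohClosed_piFlat _ _ _) H.src.piToSharp_ty
    (cohClosed_piToSharp _ _ _) H.tgt.piFlat_ty (cohClosed_piFlat _ _ _) H.tgt.piToSharp_ty
    (cohClosed_piToSharp _ _ _) ht (fun _ _ _ => rfl) (H2.tgt.toSharp_ty hk' fun _ _ _ => rfl)
    (fun _ _ _ => rfl) (app_ty H1.homMap_flat_ty hk) (fun _ _ _ => rfl)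
    (app_ty H3.homMap_sharp_ty (cvar_zero H3.ctx)) (fun _ _ _ => rfl)
    (eq_trans e2 (eq_symm e3))

end FamMapCtx

/-! ### The square for dependent function types. -/

namespace FamMapCtx

variable {Δ Γ : Zone S} {n m n' m' i j l q : ℕ} {x k : Tm S}

/-- The zone `Γ` and the function `k` are left open because the branch is used twice: with `k` a
cohesive variable when typing the map, and with `k` crisp when computing it. -/
theorem piCounitMap_branch (H : FamMapCtx R Δ true n m n' m' i j l)
    (hΓ : Derivable R (Judgment.ctx (cvar n' :: Δ) Γ))
    (hk : Derivable R (ty (cvar n' :: Δ) Γ k (piFlat S true (n + 1) (m + 1)))) :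
    Derivable R (ty (cvar n' :: Δ) Γ
      (app (app (cvar (j + 1)) (cvar 0)) (app k (flatI (app (cvar (i + 1)) (cvar 0)))))
      (fam true (m' + 1) (flatE (cvar (n' + 1)) (flatI (cvar 0)) (cvar 0)))) := by
  have H1 := H.cons H.tgt.base fun _ _ _ => rfl
  have u : Derivable R (ty (cvar n' :: Δ) [] (cvar 0) (cvar (n' + 1))) := cvar_zero H1.ctx
  have fu := app_ty H1.map u
  have kf := ty_conv (pi_elim hk (flat_intro hΓ fu)) (wkn_eq H1.ctx (H1.src.fam_counit fu) hΓ)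
  exact ty_conv (H1.famApp_ty hΓ (wkn H1.ctx u hΓ) kf)
    (wkn_eq H1.ctx (eq_symm (H1.tgt.fam_counit u)) hΓ)

theorem piCounitMap_body (H : FamMapCtx R Δ true n m n' m' i j l) :
    Derivable R (ty Δ [piFlat S true n m] (lam (flat (cvar n'))
      (flatE (app (cvar m') (flatE (cvar n') (var 0) (cvar 0))) (var 0)
        (app (app (cvar (j + 1)) (cvar 0))
          (app (var 1) (flatI (app (cvar (i + 1)) (cvar 0))))))) (piFlat S true n' m')) := by
  have c1 := ctx_coh H.ctx H.src.piFlat_ty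
  have c2 := ctx_coh c1 (flat_form c1 H.tgt.base)
  have c3 := ctx_coh c2 (flat_form c2 H.tgt.base)
  have v3 : Derivable R (ty Δ [flat (cvar n'), flat (cvar n'), piFlat S true n m] (var 0)
    (flat (cvar n'))) := var_zero c3
  have H1 := H.cons H.tgt.base fun _ _ _ => rfl
  have c1' := ctx_coh H1.ctx H1.src.piFlat_ty
  have c2' := ctx_coh c1' (flat_form c1' H1.tgt.base)
  exact pi_intro (flat_elim (H.tgt.fam_ty c3 (counit_ty H.tgt.closed c3 H.tgt.base v3))
    (var_zero c2) (H.piCounitMap_branch c2' (ty_var (j := 1) c2' rfl)))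

theorem piCounitMap_ty (H : FamMapCtx R Δ true n m n' m' i j l) :
    Derivable R (ty Δ [] (piCounitMap (cvar n) (cvar m) (cvar n') (cvar m') (cvar i) (cvar j))
      (arrow (piFlat S true n m) (piFlat S true n' m'))) :=
  pi_intro H.piCounitMap_body

theorem piCounitMap_beta (H : FamMapCtx R Δ true n m n' m' i j l)
    (hk : Derivable R (ty Δ [] (cvar q) (piFlat S true n m)))
    (hx : Derivable R (ty Δ [] x (cvar n'))) :
    Derivable R (eq Δ [] (app (app (piCounitMap (cvar n) (cvar m) (cvar n') (cvar m') (cvar i)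
      (cvar j)) (cvar q)) (flatI x)) (famApp true j x (app (cvar q) (flatI (app (cvar i) x))))
      (fam true m' x)) := by
  have H1 := H.cons H.tgt.base fun _ _ _ => rfl
  have xI := flat_intro H.ctx hx
  have e1 := pi_beta H.piCounitMap_body hk
  have hN := H.piCounitMap_branch (k := cvar (q + 1)) H1.ctx (Derivable.cwk H1.ctx hk)
  have e2 := pi_beta (flat_ind H.tgt.closed H.tgt.base (fun _ _ _ => rfl) H.tgt.fam_counit_var_ty
    rfl hN) xI
  have e3 := flat_beta (Γ := []) H.tgt.fam_counit_var_ty hx hN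
  exact eq_conv (eq_trans (pi_elim_eq e1 (eq_refl xI)) (eq_trans e2 e3)) (H.tgt.fam_counit hx)

theorem piSharpMap_body (H : FamMapCtx R Δ true n m n' m' i j l) :
    Derivable R (ty Δ [piToSharp S true n m] (lam (cvar n') (sharpI (app (app (cvar j) (var 0))
      (sharpE (app (var 1) (app (cvar i) (var 0))))))) (piToSharp S true n' m')) := by
  have H1 := H.cons H.src.piToSharp_ty (cohClosed_piToSharp _ _ _)
  have H2 := H1.cons H1.tgt.base fun _ _ _ => rfl
  have u : Derivable R (ty (cvar (n' + 1) :: piToSharp S true n m :: Δ) [] (cvar 0)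
    (cvar (n' + 2))) := cvar_zero H2.ctx
  have hh : Derivable R (ty (cvar (n' + 1) :: piToSharp S true n m :: Δ) [] (cvar 1)
    (piToSharp S true (n + 2) (m + 2))) := ty_cvar (i := 1) H2.ctx rfl
  exact pi_intro (sharp_intro (Γ := [cvar n', piToSharp S true n m])
    (M := app (app (cvar j) (var 0)) (sharpE (app (var 1) (app (cvar i) (var 0)))))
    (A := app (cvar m') (var 0))
    (H2.famApp_ty H2.ctx u (sharp_elim H2.ctx (FamCtx.piToSharp_app hh (app_ty H2.map u)))))

theorem piSharpMap_ty (H : FamMapCtx R Δ true n m n' m' i j l) :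
    Derivable R (ty Δ [] (piSharpMap (cvar n) (cvar m) (cvar n') (cvar i) (cvar j))
      (arrow (piToSharp S true n m) (piToSharp S true n' m'))) :=
  pi_intro H.piSharpMap_body

/-- Both routes send `k^♭` to `(λ x, (g x (k ((f x)^♭)))^♯)^♭`, judgmentally. -/
theorem piMap_square (H : FamMapCtx R Δ true n m n' m' i j l) :
    CommutesCrisply R Δ (flat (piFlat S true n m)) (flat (piToSharp S true n' m'))
      (letFlat (piFlat S true n m) (piToSharp S true n m) (toSharp (n + 1) (cvar 0)))
      (letFlat (piFlat S true n' m') (piToSharp S true n' m') (toSharp (n' + 1) (cvar 0)))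
      (flatMap (piFlat S true n m) (piFlat S true n' m')
        (piCounitMap (cvar n) (cvar m) (cvar n') (cvar m') (cvar i) (cvar j)))
      (flatMap (piToSharp S true n m) (piToSharp S true n' m')
        (piSharpMap (cvar n) (cvar m) (cvar n') (cvar i) (cvar j))) := by
  have H1 := H.cons H.src.piFlat_ty (cohClosed_piFlat _ _ _)
  have H2 := H.cons H.tgt.piFlat_ty (cohClosed_piFlat _ _ _)
  have H3 := H.cons H.src.piToSharp_ty (cohClosed_piToSharp _ _ _)
  have hk : Derivable R (ty _ [] (cvar 0) (piFlat S true (n + 1) (m + 1))) := cvar_zero H1.ctx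
  have hk' : Derivable R (ty _ [] (cvar 0) (piFlat S true (n' + 1) (m' + 1))) := cvar_zero H2.ctx
  have ht := H1.src.toSharp_ty hk fun _ _ _ => rfl
  have H4 := H1.cons H1.tgt.base fun _ _ _ => rfl
  have u : Derivable R (ty (cvar (n' + 1) :: piFlat S true n m :: Δ) [] (cvar 0)
    (cvar (n' + 2))) := cvar_zero H4.ctx
  -- Unlike for `homMap`, where `sharpMap` has to be computed, the body of `piSharpMap` already has
  -- the form that `toSharp_natural` expects.
  have e1 := eq_refl (sharp_intro_single (M := famApp true (j + 1) (var 0) (sharpE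
      (app (toSharp (n + 1) (cvar 0)) (app (cvar (i + 1)) (var 0)))))
    (A := fam true (m' + 1) (var 0))
    (H4.famApp_ty H4.ctx u (sharp_elim H4.ctx (FamCtx.piToSharp_app
      (H4.src.toSharp_ty (k := cvar 1) (Derivable.cwk H4.ctx hk) fun _ _ _ => rfl)
      (app_ty H4.map u)))))
  have e2 := H1.toSharp_natural (u := app (piCounitMap (cvar (n + 1)) (cvar (m + 1))
    (cvar (n' + 1)) (cvar (m' + 1)) (cvar (i + 1)) (cvar (j + 1))) (cvar 0)) hk
    (H4.piCounitMap_beta (q := 1) (Derivable.cwk H4.ctx hk) u) e1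
  have e3 := pi_beta H1.piSharpMap_body ht
  exact letFlat_square (a := app (piCounitMap (cvar (n + 1)) (cvar (m + 1))
      (cvar (n' + 1)) (cvar (m' + 1)) (cvar (i + 1)) (cvar (j + 1))) (cvar 0))
    (b := app (piSharpMap (cvar (n + 1)) (cvar (m + 1)) (cvar (n' + 1)) (cvar (i + 1))
      (cvar (j + 1))) (cvar 0))
    H.src.closed H.src.piFlat_ty (cohClosed_piFlat _ _ _) H.src.piToSharp_ty
    (cohClosed_piToSharp _ _ _) H.tgt.piFlat_ty (cohClosed_piFlat _ _ _) H.tgt.piToSharp_ty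
    (cohClosed_piToSharp _ _ _) ht (fun _ _ _ => rfl) (H2.tgt.toSharp_ty hk' fun _ _ _ => rfl)
    (fun _ _ _ => rfl) (app_ty H1.piCounitMap_ty hk) (fun _ _ _ => rfl)
    (app_ty H3.piSharpMap_ty (cvar_zero H3.ctx)) (fun _ _ _ => rfl)
    (eq_trans e2 (eq_symm e3))

end FamMapCtx

/-! ### Instantiation at crisp types -/

theorem FamCtx.univ_univ (l : ℕ) : FamCtx R [univ l, univ l] false 1 0 l := by
  have h : ClosedCtx R _ := ClosedCtx.univ_univ l
  exact ⟨h, ty_cvar (i := 1) h.ctx rfl, ty_cvar (i := 0) h.ctx rfl⟩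

theorem FamCtx.univ_family (l : ℕ) : FamCtx R [arrow (cvar 0) (univ l), univ l] true 1 0 l := by
  have h1 : ClosedCtx R _ := ClosedCtx.univ l
  have hA : Derivable R (ty _ [] (cvar 0) (univ l)) := cvar_zero h1.ctx
  -- `A → Type_l` is a type of level `l + 1`, so `A` is first lifted by cumulativity.
  have h := h1.cons (pi_form (hA.cumul_ty) (univ_ty (ctx_coh h1.ctx hA))) fun _ _ _ => rfl
  exact ⟨h, ty_cvar (i := 1) h.ctx rfl, ty_cvar (i := 0) h.ctx rfl⟩

/-- The context `A, B, A', B', f : A' → A, g : B → B'`. -/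
def homCtx (S : Signature) (l : ℕ) : Zone S :=
  [arrow (cvar 3) (cvar 1), arrow (cvar 1) (cvar 3), univ l, univ l, univ l, univ l]

theorem FamMapCtx.homCtx (l : ℕ) : FamMapCtx R (homCtx S l) false 5 4 3 2 1 0 l := by
  have h2 : ClosedCtx R _ := ClosedCtx.univ_univ l
  have h3 := h2.cons (univ_ty (l := l) h2.ctx) fun _ _ _ => rfl
  have h4 := h3.cons (univ_ty (l := l) h3.ctx) fun _ _ _ => rfl
  have h5 := h4.cons (arrow_form h4 (ty_cvar (i := 1) h4.ctx rfl) (ty_cvar (i := 3) h4.ctx rfl)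
    fun _ _ _ => rfl) fun _ _ _ => rfl
  have h := h5.cons (arrow_form h5 (ty_cvar (i := 3) h5.ctx rfl) (ty_cvar (i := 1) h5.ctx rfl)
    fun _ _ _ => rfl) fun _ _ _ => rfl
  exact ⟨⟨h, ty_cvar (i := 5) h.ctx rfl, ty_cvar (i := 4) h.ctx rfl⟩,
    ⟨h, ty_cvar (i := 3) h.ctx rfl, ty_cvar (i := 2) h.ctx rfl⟩,
    ty_cvar (i := 1) h.ctx rfl, ty_cvar (i := 0) h.ctx rfl⟩

/-- The context `A, B : A → Type, A', B' : A' → Type, f : A' → A,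
g : Π (x : A'), B (f x) → B' x`. -/
def piMapCtx (S : Signature) (l : ℕ) : Zone S :=
  [pi (cvar 2) (arrow (app (cvar 3) (app (cvar 0) (var 0))) (app (cvar 1) (var 0))),
    arrow (cvar 1) (cvar 3), arrow (cvar 0) (univ l), univ l, arrow (cvar 0) (univ l), univ l]

theorem FamMapCtx.piMapCtx (l : ℕ) : FamMapCtx R (piMapCtx S l) true 5 4 3 2 1 0 l := by
  have h2 : ClosedCtx R _ := (FamCtx.univ_family l).closed
  have h3 := h2.cons (univ_ty (l := l) h2.ctx) fun _ _ _ => rfl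
  have hA : Derivable R (ty _ [] (cvar 0) (univ l)) := cvar_zero h3.ctx
  have h4 := h3.cons (pi_form (hA.cumul_ty) (univ_ty (ctx_coh h3.ctx hA))) fun _ _ _ => rfl
  have h5 := h4.cons (arrow_form h4 (ty_cvar (i := 1) h4.ctx rfl) (ty_cvar (i := 3) h4.ctx rfl)
    fun _ _ _ => rfl) fun _ _ _ => rfl
  have hA' : Derivable R (ty _ [] (cvar 2) (univ l)) := ty_cvar (i := 2) h5.ctx rfl
  have c := ctx_coh h5.ctx hA'
  have v : Derivable R (ty _ [cvar 2] (var 0) (cvar 2)) := var_zero c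
  have hf : Derivable R (ty _ [cvar 2] (cvar 0) (arrow (cvar 2) (cvar 4))) :=
    ty_cvar (i := 0) c rfl
  have hB : Derivable R (ty _ [cvar 2] (cvar 3) (arrow (cvar 4) (univ l))) :=
    ty_cvar (i := 3) c rfl
  have hBf := app_ty hB (app_ty hf v)
  have c' := ctx_coh c hBf
  have hB' : Derivable R (ty _ [app (cvar 3) (app (cvar 0) (var 0)), cvar 2] (cvar 1)
    (arrow (cvar 2) (univ l))) := ty_cvar (i := 1) c' rfl
  have h := h5.cons (pi_form hA' (pi_form hBf (app_ty hB' (ty_var (j := 1) c' rfl))))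
    fun _ _ _ => rfl
  exact ⟨⟨h, ty_cvar (i := 5) h.ctx rfl, ty_cvar (i := 4) h.ctx rfl⟩,
    ⟨h, ty_cvar (i := 3) h.ctx rfl, ty_cvar (i := 2) h.ctx rfl⟩,
    ty_cvar (i := 1) h.ctx rfl, ty_cvar (i := 0) h.ctx rfl⟩

/-- `♭ (♭ A → B) ≃ ♭ (A → ♯ B)`, naturally in crisp `A` and `B`. -/
theorem exists_flat_hom_equivalence (l : ℕ) : ∃ φ : Tm S,
    (∀ Δ A B, IsCrispCtx R Δ → Crisp R Δ A (univ l) → Crisp R Δ B (univ l) →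
      IsCrispEquivalence R Δ (flat (arrow (flat A) B)) (flat (arrow A (sharp B)))
        (φ.cinst₂ A B)) ∧
    (∀ Δ A B A' B' f g, IsCrispCtx R Δ → Crisp R Δ A (univ l) → Crisp R Δ B (univ l) →
      Crisp R Δ A' (univ l) → Crisp R Δ B' (univ l) →
      Crisp R Δ f (arrow A' A) → Crisp R Δ g (arrow B B') →
      CommutesCrisply R Δ (flat (arrow (flat A) B)) (flat (arrow A' (sharp B')))
        (φ.cinst₂ A B) (φ.cinst₂ A' B')
        (flatMap (arrow (flat A) B) (arrow (flat A') B')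
          (homMap (flat A) B (flat A') (flatMap A' A f) g))
        (flatMap (arrow A (sharp B)) (arrow A' (sharp B'))
          (homMap A (sharp B) A' f (sharpMap B g)))) := by
  refine ⟨letFlat (piFlat S false 1 0) (piToSharp S false 1 0) (toSharp 2 (cvar 0)), ?_, ?_⟩
  · intro Δ A B hΔ hA hB
    have hs : TypedSub R [univ l, univ l] Δ ⟨fun | 0 => B | 1 => A | i + 2 => cvar i, var⟩ :=
      forall_getElem?_cons hB (forall_getElem?_cons hA forall_getElem?_nil)
    exact hs.isCrispEquivalence hΔ (FamCtx.univ_univ l).isCrispEquivalence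
  · intro Δ A B A' B' f g hΔ hA hB hA' hB' hf hg
    have hs : TypedSub R (homCtx S l) Δ
        ⟨fun | 0 => g | 1 => f | 2 => B' | 3 => A' | 4 => B | 5 => A | i + 6 => cvar i, var⟩ :=
      forall_getElem?_cons hg (forall_getElem?_cons hf (forall_getElem?_cons hB'
        (forall_getElem?_cons hA' (forall_getElem?_cons hB (forall_getElem?_cons hA
          forall_getElem?_nil)))))
    have := hs.commutesCrisply hΔ (FamMapCtx.homCtx l).homMap_square
    rw [flatMap_subst, flatMap_subst, homMap_subst, homMap_subst, flatMap_subst,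
      sharpMap_subst] at this
    exact this

/-- `♭ (Π (u : ♭ A), B (u_♭)) ≃ ♭ (Π (x : A), ♯ (B x))`, naturally in crisp `A` and `B`. -/
theorem exists_flat_pi_equivalence (l : ℕ) : ∃ φ : Tm S,
    (∀ Δ A B, IsCrispCtx R Δ → Crisp R Δ A (univ l) → Crisp R Δ B (arrow A (univ l)) →
      IsCrispEquivalence R Δ (flat (piCounit A B)) (flat (piSharp A B)) (φ.cinst₂ A B)) ∧
    (∀ Δ A B A' B' f g, IsCrispCtx R Δ →
      Crisp R Δ A (univ l) → Crisp R Δ B (arrow A (univ l)) →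
      Crisp R Δ A' (univ l) → Crisp R Δ B' (arrow A' (univ l)) →
      Crisp R Δ f (arrow A' A) →
      Crisp R Δ g (pi A' (arrow (app B.wk (app f.wk (var 0))) (app B'.wk (var 0)))) →
      CommutesCrisply R Δ (flat (piCounit A B)) (flat (piSharp A' B'))
        (φ.cinst₂ A B) (φ.cinst₂ A' B')
        (flatMap (piCounit A B) (piCounit A' B') (piCounitMap A B A' B' f g))
        (flatMap (piSharp A B) (piSharp A' B') (piSharpMap A B A' f g))) := by
  refine ⟨letFlat (piFlat S true 1 0) (piToSharp S true 1 0) (toSharp 2 (cvar 0)), ?_, ?_⟩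
  · intro Δ A B hΔ hA hB
    have hs : TypedSub R [arrow (cvar 0) (univ l), univ l] Δ
        ⟨fun | 0 => B | 1 => A | i + 2 => cvar i, var⟩ :=
      forall_getElem?_cons hB (forall_getElem?_cons hA forall_getElem?_nil)
    exact hs.isCrispEquivalence hΔ (FamCtx.univ_family l).isCrispEquivalence
  · intro Δ A B A' B' f g hΔ hA hB hA' hB' hf hg
    have hs : TypedSub R (piMapCtx S l) Δ
        ⟨fun | 0 => g | 1 => f | 2 => B' | 3 => A' | 4 => B | 5 => A | i + 6 => cvar i, var⟩ :=
      forall_getElem?_cons hg (forall_getElem?_cons hf (forall_getElem?_cons hB'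
        (forall_getElem?_cons hA' (forall_getElem?_cons hB (forall_getElem?_cons hA
          forall_getElem?_nil)))))
    have := hs.commutesCrisply hΔ (FamMapCtx.piMapCtx l).piMap_square
    rw [flatMap_subst, flatMap_subst, piCounitMap_subst, piSharpMap_subst] at this
    exact this

end SpatialTT

open SpatialTT SpatialTT.Tm in
theorem mainTheorem8 (S : Signature) (R : Set (List (Judgment S) × Judgment S)) (l : ℕ) :
    -- `♭ (♭ A → B) ≃ ♭ (A → ♯ B)`, naturally in crisp `A, B`
    (∃ φ : Tm S,
      (∀ Δ A B, IsCrispCtx R Δ → Crisp R Δ A (univ l) → Crisp R Δ B (univ l) →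
        IsCrispEquivalence R Δ (flat (arrow (flat A) B)) (flat (arrow A (sharp B)))
          (φ.cinst₂ A B)) ∧
      (∀ Δ A B A' B' f g, IsCrispCtx R Δ → Crisp R Δ A (univ l) → Crisp R Δ B (univ l) →
        Crisp R Δ A' (univ l) → Crisp R Δ B' (univ l) →
        Crisp R Δ f (arrow A' A) → Crisp R Δ g (arrow B B') →
        CommutesCrisply R Δ (flat (arrow (flat A) B)) (flat (arrow A' (sharp B')))
          (φ.cinst₂ A B) (φ.cinst₂ A' B')
          (flatMap (arrow (flat A) B) (arrow (flat A') B')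
            (homMap (flat A) B (flat A') (flatMap A' A f) g))
          (flatMap (arrow A (sharp B)) (arrow A' (sharp B'))
            (homMap A (sharp B) A' f (sharpMap B g))))) ∧
    -- `♭ (Π (u : ♭ A), B (u_♭)) ≃ ♭ (Π (x : A), ♯ (B x))`, naturally in crisp `A, B`
    (∃ φ : Tm S,
      (∀ Δ A B, IsCrispCtx R Δ → Crisp R Δ A (univ l) → Crisp R Δ B (arrow A (univ l)) →
        IsCrispEquivalence R Δ (flat (piCounit A B)) (flat (piSharp A B)) (φ.cinst₂ A B)) ∧
      (∀ Δ A B A' B' f g, IsCrispCtx R Δ →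
        Crisp R Δ A (univ l) → Crisp R Δ B (arrow A (univ l)) →
        Crisp R Δ A' (univ l) → Crisp R Δ B' (arrow A' (univ l)) →
        Crisp R Δ f (arrow A' A) →
        Crisp R Δ g (pi A' (arrow (app B.wk (app f.wk (var 0))) (app B'.wk (var 0)))) →
        CommutesCrisply R Δ (flat (piCounit A B)) (flat (piSharp A' B'))
          (φ.cinst₂ A B) (φ.cinst₂ A' B')
          (flatMap (piCounit A B) (piCounit A' B') (piCounitMap A B A' B' f g))
          (flatMap (piSharp A B) (piSharp A' B') (piSharpMap A B A' f g)))) ∧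
    -- `♯ ♭ A ≃ ♯ A`, naturally in crisp `A`
    (∃ φ : Tm S,
      (∀ Δ A, IsCrispCtx R Δ → Crisp R Δ A (univ l) →
        IsCrispEquivalence R Δ (sharp (flat A)) (sharp A) (φ.cinst A)) ∧
      (∀ Δ A A' f, IsCrispCtx R Δ → Crisp R Δ A (univ l) → Crisp R Δ A' (univ l) →
        Crisp R Δ f (arrow A A') →
        CommutesCrisply R Δ (sharp (flat A)) (sharp A') (φ.cinst A) (φ.cinst A')
          (sharpMap (flat A) (flatMap A A' f)) (sharpMap A f))) ∧
    -- `♭ A ≃ ♭ ♯ A`, naturally in crisp `A`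
    (∃ φ : Tm S,
      (∀ Δ A, IsCrispCtx R Δ → Crisp R Δ A (univ l) →
        IsCrispEquivalence R Δ (flat A) (flat (sharp A)) (φ.cinst A)) ∧
      (∀ Δ A A' f, IsCrispCtx R Δ → Crisp R Δ A (univ l) → Crisp R Δ A' (univ l) →
        Crisp R Δ f (arrow A A') →
        CommutesCrisply R Δ (flat A) (flat (sharp A')) (φ.cinst A) (φ.cinst A')
          (flatMap A A' f) (flatMap (sharp A) (sharp A') (sharpMap A f)))) :=
  ⟨exists_flat_hom_equivalence l, exists_flat_pi_equivalence l, exists_sharp_flat_equivalence l,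
    exists_flat_sharp_equivalence l⟩
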